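/- Let $1\le k_2<N$, let $x_0,\dots,x_N$ be random vectors in $\mathbb{R}^d$ on a common probability space. A sequence $[x_k]=(x_0,\dots,x_N)$ is called zero-mean nonsingular Gaussian (ZMNG) if $x_0,\dots,x_N$ are jointly Gaussian with mean zero and the covariance matrix of the stacked vector $(x_0',\dots,x_N')'$ is nonsingular; it is white if $\mathrm{Cov}(x_i,x_j)=0$ for $i\ne j$. For $0<m\le N$ it is called $[0,m]$-$CM_L$ if, conditioned on $x_m$, it is Markov over $[0,m-1]$, i.e. for every $j\in[0,m]$ and every event $A\in\sigma(x_{j+1},\dots,x_m)$, $P(A\mid x_0,\dots,x_j,x_m)=P(A\mid x_j,x_m)$ almost surely; $CM_L$ means $[0,N]$-$CM_L$. Then $[x_k]$ is a ZMNG sequence that is both $CM_L$ and $[0,k_2]$-$CM_L$ if and only if there are real $d\times d$ matrices $G_{k,i}$ and a zero-mean white nonsingular Gaussian sequence $[e_k]=(e_0,\dots,e_N)$, with $G_k=\mathrm{Cov}(e_k)$, such that, almost surely, $$x_k=G_{k,k-1}x_{k-1}+G_{k,k_2}x_{k_2}+e_k,\qquad k\in[1,k_2-1],$$ $$x_{k_2}=e_{k_2},\qquad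 x_0=G_{0,k_2}x_{k_2}+e_0,$$ $$x_N=\sum_{i=0}^{k_2}G_{N,i}x_i+e_N,$$ $$x_k=G_{k,k-1}x_{k-1}+G_{k,N}x_N+e_k,\qquad k\in[k_2+1,N-1],$$ and the parameters satisfy $$G_{N,j}'G_N^{-1}G_{N,i}=0\qquad\text{for } j=0,\dots,k_2-3,\ i=j+2,\dots,k_2-1,$$ $$G_l^{-1}G_{l,k_2}=G_{l+1,l}'G_{l+1}^{-1}G_{l+1,k_2}+G_{N,l}'G_N^{-1}G_{N,k_2}\qquad\text{for } l=0,\dots,k_2-2.$$ In particular, a ZMNG sequence is $CM_L\cap[0,k_2]$-$CM_L$ if and only if it obeys this model. -/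

import Mathlib

open MeasureTheory ProbabilityTheory Filter Matrix

namespace GaussCM

/-- Cross-covariance matrix `Cov(Y, Z)` of two random vectors. -/
noncomputable def crossCov {Ω : Type*} [MeasurableSpace Ω] (μ : Measure Ω) {d : ℕ}
    (Y Z : Ω → Fin d → ℝ) : Matrix (Fin d) (Fin d) ℝ :=
  Matrix.of fun a b => cov[fun ω => Y ω a, fun ω => Z ω b; μ]

/-- Covariance matrix `Cov(Y)` of a random vector. -/
noncomputable def covMat {Ω : Type*} [MeasurableSpace Ω] (μ : Measure Ω) {d : ℕ}
    (Y : Ω → Fin d → ℝ) : Matrix (Fin d) (Fin d) ℝ :=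
  crossCov μ Y Y

/-- Covariance matrix of the stacked vector `(X 0, …, X N)`; the entry at `((i, a), (j, b))` is
the covariance of the `a`-th coordinate of `X i` and the `b`-th coordinate of `X j`. -/
noncomputable def seqCov {Ω : Type*} [MeasurableSpace Ω] (μ : Measure Ω) {d : ℕ} (N : ℕ)
    (X : ℕ → Ω → Fin d → ℝ) : Matrix (Fin (N + 1) × Fin d) (Fin (N + 1) × Fin d) ℝ :=
  Matrix.of fun p q => crossCov μ (X p.1) (X q.1) p.2 q.2

/-- `X 0, …, X N` is a zero-mean nonsingular Gaussian (ZMNG) sequence: the variables are jointly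
Gaussian, have mean zero, and the covariance matrix of the whole sequence is nonsingular.
(The values of `X` at times after `N` play no role, here and below.) -/
structure IsZMNG {Ω : Type*} [MeasurableSpace Ω] (μ : Measure Ω) {d : ℕ} (N : ℕ)
    (X : ℕ → Ω → Fin d → ℝ) : Prop where
  gaussian : HasGaussianLaw (fun ω (k : Fin (N + 1)) => X k ω) μ
  mean_zero : ∀ k ≤ N, ∀ a : Fin d, ∫ ω, X k ω a ∂μ = 0
  nonsingular : IsUnit (seqCov μ N X).det

/-- `e 0, …, e N` is a zero-mean white nonsingular Gaussian sequence: it is ZMNG, and its values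
at different times are uncorrelated. -/
structure IsWhiteZMNG {Ω : Type*} [MeasurableSpace Ω] (μ : Measure Ω) {d : ℕ} (N : ℕ)
    (e : ℕ → Ω → Fin d → ℝ) : Prop extends IsZMNG μ N e where
  white : ∀ i ≤ N, ∀ j ≤ N, i ≠ j → crossCov μ (e i) (e j) = 0

/-- The σ-algebra generated by the variables `X i`, `i ∈ s`. -/
@[reducible] def sigmaOf {Ω : Type*} {d : ℕ} (X : ℕ → Ω → Fin d → ℝ) (s : Set ℕ) : MeasurableSpace Ω :=
  ⨆ i ∈ s, MeasurableSpace.comap (X i) inferInstance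

/-- The sequence `X` is `[k₁, k₂]`-`CM_c`, for `c = k₁` or `c = k₂`: conditioned on `X c` it is
Markov over the rest of `[k₁, k₂]`. That is, for every time `j` in `[k₁, k₂]` and every event `A`
of the future `σ(X i : j < i ≤ k₂)`,
`P(A | (X i : k₁ ≤ i ≤ j), X c) = P(A | X j, X c)` almost surely. -/
def IsCM {Ω : Type*} [MeasurableSpace Ω] (μ : Measure Ω) {d : ℕ} (X : ℕ → Ω → Fin d → ℝ)
    (k₁ k₂ c : ℕ) : Prop :=
  ∀ j, k₁ ≤ j → j ≤ k₂ → ∀ A : Set Ω, MeasurableSet[sigmaOf X (Set.Ioc j k₂)] A →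
    μ⟦A | sigmaOf X (Set.Icc k₁ j ∪ {c})⟧ =ᵐ[μ] μ⟦A | sigmaOf X {j, c}⟧

/-- `[k₁, k₂]`-`CM_L`: conditionally Markov over `[k₁, k₂]`, conditioning on the last time. -/
def IsCML {Ω : Type*} [MeasurableSpace Ω] (μ : Measure Ω) {d : ℕ} (X : ℕ → Ω → Fin d → ℝ)
    (k₁ k₂ : ℕ) : Prop :=
  IsCM μ X k₁ k₂ k₂

/-- `X` obeys, almost surely, the dynamic model with coefficient matrices `G k i` and noise `e`:
up to time `k₂` it is driven conditionally on `X k₂`, then `X N` is a linear combination of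
`X 0, …, X k₂` plus noise, and strictly between `k₂` and `N` it is driven conditionally on
`X N`. -/
structure ObeysModel {Ω : Type*} [MeasurableSpace Ω] (μ : Measure Ω) {d : ℕ} (N k₂ : ℕ)
    (G : ℕ → ℕ → Matrix (Fin d) (Fin d) ℝ) (e X : ℕ → Ω → Fin d → ℝ) : Prop where
  before : ∀ k, 1 ≤ k → k < k₂ →
    ∀ᵐ ω ∂μ, X k ω = G k (k - 1) *ᵥ X (k - 1) ω + G k k₂ *ᵥ X k₂ ω + e k ω
  waypoint : ∀ᵐ ω ∂μ, X k₂ ω = e k₂ ω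
  initial : ∀ᵐ ω ∂μ, X 0 ω = G 0 k₂ *ᵥ X k₂ ω + e 0 ω
  destination : ∀ᵐ ω ∂μ, X N ω = (∑ i ∈ Finset.Icc 0 k₂, G N i *ᵥ X i ω) + e N ω
  after : ∀ k, k₂ + 1 ≤ k → k < N →
    ∀ᵐ ω ∂μ, X k ω = G k (k - 1) *ᵥ X (k - 1) ω + G k N *ᵥ X N ω + e k ω

end GaussCM

namespace GaussCM

/-! For a nonsingular Gaussian sequence, being `[0, m]`-`CM_L` is a linear condition, `IsOneStep`:
for `0 < k < m`, the regression of `x_k` on `x_0, …, x_{k-1}, x_m` uses only `x_{k-1}` and `x_m`.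
Since uncorrelated jointly Gaussian vectors are independent, the translation works both ways
(`IsZMNG.isOneStep_of_isCML`, `IsZMNG.isCML_of_isOneStep`). The rest is linear algebra in the module
of square-integrable random vectors over the `d × d` matrices, with the cross-covariance as a
matrix-valued form.

Order the times as `k₂, 0, …, k₂ - 1, N, k₂ + 1, …, N - 1`. The Gram–Schmidt residuals in this order
are white, and the two one-step properties reduce the regressions to those of the model
(`exists_isModel`). Conversely, whiteness of the noise in the model gives the one-step property
towards `k₂`, and the one towards `N` at times after `k₂`. Only the one-step property towards `N` at
times `k ≤ k₂` is not built in; it is equivalent to the parameter conditions.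

To see this, write `S_k = Cov(e_k)` and, for `l + 2 ≤ k₂`, let `D_l = S_l⁻¹ e_l - G_{l+1,l}'
S_{l+1}⁻¹ e_{l+1} - G_{N,l}' S_N⁻¹ e_N` (`dualNoise`). It has covariance `1` with `x_l` and `0` with
the other vectors among `x_0, …, x_{k₂}, x_N`, so its coefficients in these vectors form row `l` of
their precision matrix. The entries at `l + 2 ≤ j ≤ k₂` are `dualCoeff`; they vanish exactly when
the parameter conditions hold, the first condition being `j < k₂` and the second `j = k₂`. Pairing
`D_l` with one-step residuals forces these entries to vanish (`IsModel.dualCoeff_eq_zero`). If they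
vanish, `D_l` is a combination of `x_0, …, x_{l+1}, x_N`, and pairing it with the regression
residual of `x_k` removes `x_l` from that regression for `l ≤ k - 2`
(`IsModel.isOneStep_destination`). -/

/-- Real square matrices of size `d`. -/
abbrev SqMat (d : ℕ) : Type := Matrix (Fin d) (Fin d) ℝ

/-! ### Matrix-valued covariance forms. -/

/-- A matrix-valued form with the algebraic properties of the cross-covariance. -/
structure IsCovForm {d : ℕ} {E : Type*} [AddCommGroup E] [Module (SqMat d) E]
    (B : E → E → SqMat d) : Prop where
  add_left : ∀ x y z, B (x + y) z = B x z + B y z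
  smul_left : ∀ (A : SqMat d) y z, B (A • y) z = A * B y z
  symm : ∀ y z, B y z = (B z y)ᵀ

/-- The form `B` is definite on the combinations of `X 0, …, X N`, which are independent. -/
def IsNondeg {d : ℕ} {E : Type*} [AddCommGroup E] [Module (SqMat d) E]
    (B : E → E → SqMat d) (N : ℕ) (X : ℕ → E) : Prop :=
  ∀ C : ℕ → SqMat d, B (∑ j ∈ Finset.range (N + 1), C j • X j)
    (∑ j ∈ Finset.range (N + 1), C j • X j) = 0 → ∀ j ≤ N, C j = 0

namespace IsCovForm

variable {d : ℕ} {E : Type*} [AddCommGroup E] [Module (SqMat d) E] {B : E → E → SqMat d}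

/-- The form with its second argument fixed, as a linear map. -/
def left (hB : IsCovForm B) (z : E) : E →ₗ[SqMat d] SqMat d where
  toFun y := B y z
  map_add' x y := hB.add_left x y z
  map_smul' A y := hB.smul_left A y z

lemma zero_left (hB : IsCovForm B) (z : E) : B 0 z = 0 := (hB.left z).map_zero

lemma sub_left (hB : IsCovForm B) (x y z : E) : B (x - y) z = B x z - B y z :=
  (hB.left z).map_sub x y

lemma sum_left (hB : IsCovForm B) {ι : Type*} (s : Finset ι) (f : ι → E) (z : E) :
    B (∑ i ∈ s, f i) z = ∑ i ∈ s, B (f i) z := map_sum (hB.left z) f s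

lemma add_right (hB : IsCovForm B) (x y z : E) : B z (x + y) = B z x + B z y := by
  rw [hB.symm, hB.add_left, transpose_add, ← hB.symm, ← hB.symm]

lemma sub_right (hB : IsCovForm B) (x y z : E) : B z (x - y) = B z x - B z y := by
  rw [hB.symm, hB.sub_left, transpose_sub, ← hB.symm, ← hB.symm]

lemma smul_right (hB : IsCovForm B) (A : SqMat d) (y z : E) : B z (A • y) = B z y * Aᵀ := by
  rw [hB.symm, hB.smul_left, transpose_mul, ← hB.symm]

lemma sum_right (hB : IsCovForm B) {ι : Type*} (s : Finset ι) (f : ι → E) (z : E) :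
    B z (∑ i ∈ s, f i) = ∑ i ∈ s, B z (f i) := by
  rw [hB.symm, hB.sum_left, transpose_sum]
  exact Finset.sum_congr rfl fun i _ => (hB.symm _ _).symm

lemma symm_eq_zero (hB : IsCovForm B) {y z : E} (h : B y z = 0) : B z y = 0 := by
  rw [hB.symm, h, transpose_zero]

lemma left_eq_zero_of_mem_span (hB : IsCovForm B) {X : ℕ → E} {s : Set ℕ} {p z : E}
    (h : ∀ i ∈ s, B (X i) z = 0) (hp : p ∈ Submodule.span (SqMat d) (X '' s)) : B p z = 0 := by
  have : Submodule.span (SqMat d) (X '' s) ≤ LinearMap.ker (hB.left z) := by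
    rw [Submodule.span_le]
    rintro _ ⟨i, hi, rfl⟩
    exact h i hi
  exact this hp

lemma right_eq_zero_of_mem_span (hB : IsCovForm B) {X : ℕ → E} {s : Set ℕ} {p z : E}
    (h : ∀ i ∈ s, B z (X i) = 0) (hp : p ∈ Submodule.span (SqMat d) (X '' s)) : B z p = 0 :=
  hB.symm_eq_zero (hB.left_eq_zero_of_mem_span (fun i hi => hB.symm_eq_zero (h i hi)) hp)

end IsCovForm

/-! ### Projections and triangular systems. -/

section Linear

variable {d : ℕ} {E : Type*} [AddCommGroup E] [Module (SqMat d) E] {B : E → E → SqMat d}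
  {N : ℕ} {X : ℕ → E}

lemma span_image_mono {s t : Set ℕ} (X : ℕ → E) (h : ∀ i ∈ s, i ∈ t) :
    Submodule.span (SqMat d) (X '' s) ≤ Submodule.span (SqMat d) (X '' t) :=
  Submodule.span_mono (Set.image_mono h)

lemma exists_coeff_of_mem_span {s : Set ℕ} (hs : ∀ t ∈ s, t ≤ N) {p : E}
    (hp : p ∈ Submodule.span (SqMat d) (X '' s)) :
    ∃ C : ℕ → SqMat d, (∀ t, t ∉ s → C t = 0) ∧ p = ∑ t ∈ Finset.range (N + 1), C t • X t := by
  induction hp using Submodule.span_induction with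
  | mem x hx =>
    obtain ⟨i, hi, rfl⟩ := hx
    refine ⟨fun t => if t = i then 1 else 0, fun t ht => if_neg ?_, ?_⟩
    · rintro rfl; exact ht hi
    · have := hs i hi
      simp [ite_smul, Nat.lt_succ_of_le this]
  | zero => exact ⟨0, by simp, by simp⟩
  | add x y _ _ hx hy =>
    obtain ⟨C, hC, rfl⟩ := hx
    obtain ⟨D, hD, rfl⟩ := hy
    exact ⟨C + D, fun t ht => by simp [hC t ht, hD t ht], by
      simp [add_smul, Finset.sum_add_distrib]⟩
  | smul a x _ hx =>
    obtain ⟨C, hC, rfl⟩ := hx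
    exact ⟨fun t => a * C t, fun t ht => by simp [hC t ht], by
      simp [mul_smul, Finset.smul_sum]⟩

lemma IsNondeg.isUnit_residual (hX : IsNondeg B N X) (hB : IsCovForm B) {i : ℕ} (hi : i ≤ N)
    {s : Set ℕ} (hs : ∀ t ∈ s, t ≤ N) (his : i ∉ s) {p : E}
    (hp : p ∈ Submodule.span (SqMat d) (X '' s)) : IsUnit (B (X i - p) (X i - p)).det := by
  by_contra hdet
  rw [isUnit_iff_ne_zero, not_not] at hdet
  obtain ⟨v, hv0, hv⟩ := Matrix.exists_vecMul_eq_zero_iff.2 hdet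
  obtain ⟨C, hC, hpC⟩ := exists_coeff_of_mem_span hs hp
  -- All rows of `A` are the null vector `v`, so `A • (X i - p)` has zero covariance. Its
  -- coefficient at `X i` is `A` itself, because `p` does not involve `X i`.
  set A : SqMat d := Matrix.of fun _ => v
  have hAD : A * B (X i - p) (X i - p) = 0 := by
    ext a b
    exact congrFun hv b
  have hq : A • (X i - p) =
      ∑ t ∈ Finset.range (N + 1), (A * ((if t = i then 1 else 0) - C t)) • X t := by
    rw [hpC]
    simp only [mul_smul, sub_smul, ite_smul, one_smul, zero_smul, ← Finset.smul_sum,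
      Finset.sum_sub_distrib, Finset.sum_ite_eq', Finset.mem_range, Nat.lt_succ_of_le hi, if_true]
  have := hX _ (by rw [← hq, hB.smul_left, hB.smul_right, ← mul_assoc, hAD, zero_mul]) i hi
  rw [if_pos rfl, hC i his, sub_zero, mul_one] at this
  apply hv0
  ext a
  exact congrFun (congrFun this a) a

/-- Gram–Schmidt, one vector at a time: each new vector enters through its residual, whose
covariance is invertible. -/
lemma IsNondeg.exists_projection (hX : IsNondeg B N X) (hB : IsCovForm B)
    {s : Set ℕ} (hs : ∀ t ∈ s, t ≤ N) (y : E) :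
    ∃ p ∈ Submodule.span (SqMat d) (X '' s), ∀ i ∈ s, B (y - p) (X i) = 0 := by
  have hfin : s.Finite := (Set.finite_Iic N).subset hs
  induction s, hfin using Set.Finite.induction_on generalizing y with
  | empty => exact ⟨0, Submodule.zero_mem _, by simp⟩
  | @insert i s his hsf ih =>
    have hs' : ∀ t ∈ s, t ≤ N := fun t ht => hs t (Set.mem_insert_of_mem _ ht)
    obtain ⟨p, hp, hpo⟩ := ih hs' y
    obtain ⟨q, hq, hqo⟩ := ih hs' (X i)
    have hle : Submodule.span (SqMat d) (X '' s) ≤ Submodule.span (SqMat d) (X '' insert i s) :=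
      span_image_mono X fun t ht => Set.mem_insert_of_mem _ ht
    have hu := hX.isUnit_residual hB (hs i (Set.mem_insert _ _)) hs' his hq
    set r := X i - q with hr
    have hrr : B r (X i) = B r r := by
      rw [hr, hB.sub_right, ← hr, hB.right_eq_zero_of_mem_span hqo hq, sub_zero]
    have hyr : B (y - p) (X i) = B (y - p) r := by
      rw [hr, hB.sub_right, hB.right_eq_zero_of_mem_span hpo hq, sub_zero]
    refine ⟨p + (B (y - p) r * (B r r)⁻¹) • r, ?_, ?_⟩
    · refine Submodule.add_mem _ (hle hp) (Submodule.smul_mem _ _ (Submodule.sub_mem _ ?_ (hle hq)))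
      exact Submodule.subset_span ⟨i, Set.mem_insert _ _, rfl⟩
    · intro j hj
      rw [← sub_sub, hB.sub_left, hB.smul_left]
      rcases hj with rfl | hj
      · rw [hrr, hyr, mul_assoc, Matrix.nonsing_inv_mul _ hu, mul_one, sub_self]
      · rw [hpo j hj, hqo j hj, mul_zero, sub_zero]

/-- The combinations that express `X k` through the `X j` of smaller rank, up to `e k`. -/
def IsTriangular (r : ℕ → ℕ) (N : ℕ) (e X : ℕ → E) : Prop :=
  ∀ k ≤ N, X k - e k ∈ Submodule.span (SqMat d) (X '' {j | j ≤ N ∧ r j < r k})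

variable {r : ℕ → ℕ} {e : ℕ → E}

lemma IsTriangular.mem_span_noise (h : IsTriangular (d := d) r N e X) {k : ℕ} (hk : k ≤ N) :
    X k ∈ Submodule.span (SqMat d) (e '' {j | j ≤ N ∧ r j ≤ r k}) := by
  induction hn : r k using Nat.strong_induction_on generalizing k with
  | _ n ih =>
    subst hn
    have h1 : Submodule.span (SqMat d) (X '' {j | j ≤ N ∧ r j < r k}) ≤
        Submodule.span (SqMat d) (e '' {j | j ≤ N ∧ r j ≤ r k}) := by
      rw [Submodule.span_le]
      rintro _ ⟨j, ⟨hj, hjk⟩, rfl⟩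
      have h2 : Submodule.span (SqMat d) (e '' {t | t ≤ N ∧ r t ≤ r j}) ≤
          Submodule.span (SqMat d) (e '' {t | t ≤ N ∧ r t ≤ r k}) :=
        span_image_mono e fun t ht => ⟨ht.1, ht.2.trans hjk.le⟩
      exact h2 (ih _ hjk hj rfl)
    have h2 : e k ∈ Submodule.span (SqMat d) (e '' {j | j ≤ N ∧ r j ≤ r k}) :=
      Submodule.subset_span ⟨k, ⟨hk, le_rfl⟩, rfl⟩
    have := Submodule.add_mem _ (h1 (h k hk)) h2
    rwa [sub_add_cancel] at this

lemma IsTriangular.noise_mem_span (h : IsTriangular (d := d) r N e X) {k : ℕ} (hk : k ≤ N) :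
    e k ∈ Submodule.span (SqMat d) (X '' {j | j ≤ N ∧ r j ≤ r k}) := by
  have h1 : X k ∈ Submodule.span (SqMat d) (X '' {j | j ≤ N ∧ r j ≤ r k}) :=
    Submodule.subset_span ⟨k, ⟨hk, le_rfl⟩, rfl⟩
  have h2 : Submodule.span (SqMat d) (X '' {j | j ≤ N ∧ r j < r k}) ≤
      Submodule.span (SqMat d) (X '' {j | j ≤ N ∧ r j ≤ r k}) :=
    span_image_mono X fun t ht => ⟨ht.1, le_of_lt ht.2⟩
  have := Submodule.sub_mem _ h1 (h2 (h k hk))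
  rwa [sub_sub_cancel] at this

/-- Solving the triangular system writes `X j` through noises of rank at most `r j`, none of which
is `e k`. The next lemma is the converse passage, from orthogonality to whiteness. -/
lemma IsTriangular.noise_orthogonal (h : IsTriangular (d := d) r N e X) (hB : IsCovForm B)
    (hw : ∀ i ≤ N, ∀ j ≤ N, i ≠ j → B (e i) (e j) = 0) {k j : ℕ} (hk : k ≤ N) (hj : j ≤ N)
    (hjk : r j < r k) : B (e k) (X j) = 0 := by
  refine hB.right_eq_zero_of_mem_span (fun i hi => hw k hk i hi.1 ?_) (h.mem_span_noise hj)
  rintro rfl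
  exact absurd hi.2 (not_le.2 hjk)

lemma IsTriangular.white (h : IsTriangular (d := d) r N e X) (hB : IsCovForm B)
    (hr : ∀ i ≤ N, ∀ j ≤ N, r i = r j → i = j)
    (ho : ∀ k ≤ N, ∀ j ≤ N, r j < r k → B (e k) (X j) = 0) :
    ∀ i ≤ N, ∀ j ≤ N, i ≠ j → B (e i) (e j) = 0 := by
  have key : ∀ i ≤ N, ∀ j ≤ N, r j < r i → B (e i) (e j) = 0 := fun i hi j hj hji =>
    hB.right_eq_zero_of_mem_span (fun t ht => ho i hi t ht.1 (ht.2.trans_lt hji))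
      (h.noise_mem_span hj)
  intro i hi j hj hij
  rcases lt_trichotomy (r i) (r j) with h1 | h1 | h1
  · exact hB.symm_eq_zero (key j hj i hi h1)
  · exact absurd (hr i hi j hj h1) hij
  · exact key i hi j hj h1

lemma IsTriangular.noise_self (h : IsTriangular (d := d) r N e X) (hB : IsCovForm B)
    (ho : ∀ k ≤ N, ∀ j ≤ N, r j < r k → B (e k) (X j) = 0) {k : ℕ} (hk : k ≤ N) :
    B (e k) (X k) = B (e k) (e k) := by
  rw [← sub_eq_zero, ← hB.sub_right]
  exact hB.right_eq_zero_of_mem_span (fun t ht => ho k hk t ht.1 ht.2) (h k hk)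

lemma IsTriangular.isUnit_noise (h : IsTriangular (d := d) r N e X) (hB : IsCovForm B)
    (hX : IsNondeg B N X) {k : ℕ} (hk : k ≤ N) : IsUnit (B (e k) (e k)).det := by
  have := hX.isUnit_residual hB hk (s := {j | j ≤ N ∧ r j < r k}) (fun t ht => ht.1)
    (fun hh => lt_irrefl _ hh.2) (h k hk)
  rwa [sub_sub_cancel] at this

end Linear

/-! ### The dynamic model and its precision matrix. -/

section Model

variable {d : ℕ} {E : Type*} [AddCommGroup E] [Module (SqMat d) E] {B : E → E → SqMat d}
  {N k₂ : ℕ} {X e : ℕ → E} {G : ℕ → ℕ → SqMat d}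

/-- The order in which the model generates the variables. -/
def modelRank (N k₂ k : ℕ) : ℕ :=
  if k = k₂ then 0 else if k = N then k₂ + 1 else k + 1

lemma modelRank_injOn (_ : k₂ < N) {i j : ℕ} (_ : i ≤ N) (_ : j ≤ N)
    (h : modelRank N k₂ i = modelRank N k₂ j) : i = j := by
  unfold modelRank at h
  grind

/-- The noiseless right-hand side of the dynamic model at time `k`. -/
def modelRhs (N k₂ : ℕ) (g : ℕ → SqMat d) (X : ℕ → E) (k : ℕ) : E :=
  if k = k₂ then 0
  else if k = N then ∑ i ∈ Finset.Icc 0 k₂, g i • X i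
  else if k = 0 then g k₂ • X k₂
  else if k < k₂ then g (k - 1) • X (k - 1) + g k₂ • X k₂
  else g (k - 1) • X (k - 1) + g N • X N

/-- The dynamic model as an identity in a module. -/
def IsModel (N k₂ : ℕ) (G : ℕ → ℕ → SqMat d) (e X : ℕ → E) : Prop :=
  ∀ k ≤ N, X k = modelRhs N k₂ (G k) X k + e k

/-- The one-step regression of `X k` on its past and on `X m` involves only `X (k - 1)` and
`X m`, for all `0 < k < m`. -/
def IsOneStep (B : E → E → SqMat d) (X : ℕ → E) (m : ℕ) : Prop :=
  ∀ k, 1 ≤ k → k < m → ∃ P Q : SqMat d, ∀ i, (i < k ∨ i = m) →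
    B (X k - (P • X (k - 1) + Q • X m)) (X i) = 0

lemma modelRhs_mem_span (hN : k₂ < N) (g : ℕ → SqMat d) (X : ℕ → E) {k : ℕ} (hk : k ≤ N) :
    modelRhs N k₂ g X k ∈ Submodule.span (SqMat d)
      (X '' {j | j ≤ N ∧ modelRank N k₂ j < modelRank N k₂ k}) := by
  have key : ∀ j, j ≤ N → modelRank N k₂ j < modelRank N k₂ k → ∀ A : SqMat d,
      A • X j ∈ Submodule.span (SqMat d)
        (X '' {j | j ≤ N ∧ modelRank N k₂ j < modelRank N k₂ k}) := fun j h1 h2 A =>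
    Submodule.smul_mem _ _ (Submodule.subset_span ⟨j, ⟨h1, h2⟩, rfl⟩)
  unfold modelRhs
  split_ifs with h1 h2 h3 h4
  · exact Submodule.zero_mem _
  · refine Submodule.sum_mem _ fun i hi => key i ?_ ?_ _
    · have := (Finset.mem_Icc.1 hi).2; omega
    · have := (Finset.mem_Icc.1 hi).2
      unfold modelRank; grind
  · exact key _ hN.le (by unfold modelRank; grind) _
  · exact Submodule.add_mem _ (key _ (by omega) (by unfold modelRank; grind) _)
      (key _ hN.le (by unfold modelRank; grind) _)
  · exact Submodule.add_mem _ (key _ (by omega) (by unfold modelRank; grind) _)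
      (key _ le_rfl (by unfold modelRank; grind) _)

lemma IsModel.isTriangular (h : IsModel N k₂ G e X) (hN : k₂ < N) :
    IsTriangular (d := d) (modelRank N k₂) N e X := fun k hk => by
  nth_rewrite 1 [h k hk]
  rw [add_sub_cancel_right]
  exact modelRhs_mem_span hN _ _ hk

lemma IsModel.waypoint (h : IsModel N k₂ G e X) (hN : k₂ < N) : X k₂ = e k₂ := by
  rw [h k₂ hN.le, modelRhs, if_pos rfl, zero_add]

lemma IsModel.destination (h : IsModel N k₂ G e X) (hN : k₂ < N) :
    X N = (∑ i ∈ Finset.Icc 0 k₂, G N i • X i) + e N := by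
  conv_lhs => rw [h N le_rfl, modelRhs, if_neg (by omega), if_pos rfl]

lemma IsModel.before (h : IsModel N k₂ G e X) (hN : k₂ < N) {k : ℕ} (hk : k + 1 < k₂) :
    X (k + 1) = G (k + 1) k • X k + G (k + 1) k₂ • X k₂ + e (k + 1) := by
  conv_lhs => rw [h (k + 1) (by omega), modelRhs, if_neg (by omega), if_neg (by omega),
    if_neg (by omega), if_pos hk, Nat.add_sub_cancel]

lemma IsModel.after (h : IsModel N k₂ G e X) {k : ℕ} (hk : k₂ < k) (hkN : k < N) :
    X k = G k (k - 1) • X (k - 1) + G k N • X N + e k := by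
  conv_lhs => rw [h k (by omega), modelRhs, if_neg (by omega), if_neg (by omega),
    if_neg (by omega), if_neg (by omega)]

lemma IsModel.initial (h : IsModel N k₂ G e X) (hk₂ : 1 ≤ k₂) (hN : k₂ < N) :
    X 0 = G 0 k₂ • X k₂ + e 0 := by
  conv_lhs => rw [h 0 (by omega), modelRhs, if_neg (by omega), if_neg (by omega), if_pos rfl]

/-- A combination of the noises dual to `X l`. -/
noncomputable def dualNoise (B : E → E → SqMat d) (N : ℕ) (G : ℕ → ℕ → SqMat d) (e : ℕ → E)
    (l : ℕ) : E :=
  (B (e l) (e l))⁻¹ • e l - ((G (l + 1) l)ᵀ * (B (e (l + 1)) (e (l + 1)))⁻¹) • e (l + 1) -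
    ((G N l)ᵀ * (B (e N) (e N))⁻¹) • e N

/-- The coefficient of `dualNoise B N G e l` at `X j`, for `l + 2 ≤ j ≤ k₂`. -/
noncomputable def dualCoeff (B : E → E → SqMat d) (N k₂ : ℕ) (G : ℕ → ℕ → SqMat d) (e : ℕ → E)
    (l j : ℕ) : SqMat d :=
  (G N l)ᵀ * (B (e N) (e N))⁻¹ * G N j +
    if j = k₂ then (G (l + 1) l)ᵀ * (B (e (l + 1)) (e (l + 1)))⁻¹ * G (l + 1) k₂ -
      (B (e l) (e l))⁻¹ * G l k₂ else 0

lemma dualNoise_left (hB : IsCovForm B) (G : ℕ → ℕ → SqMat d) (e : ℕ → E) (l : ℕ) (y : E) :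
    B (dualNoise B N G e l) y = (B (e l) (e l))⁻¹ * B (e l) y -
      (G (l + 1) l)ᵀ * (B (e (l + 1)) (e (l + 1)))⁻¹ * B (e (l + 1)) y -
      (G N l)ᵀ * (B (e N) (e N))⁻¹ * B (e N) y := by
  rw [dualNoise, hB.sub_left, hB.sub_left, hB.smul_left, hB.smul_left, hB.smul_left]

/-- For `j ≤ l` only the `e l` term can contribute; for larger `j < k₂` the pairing is propagated
along the recursion of the model. -/
lemma IsModel.dualNoise_apply (h : IsModel N k₂ G e X) (hB : IsCovForm B)
    (hN : k₂ < N) (hw : ∀ i ≤ N, ∀ j ≤ N, i ≠ j → B (e i) (e j) = 0)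
    (hu : ∀ k ≤ N, IsUnit (B (e k) (e k)).det) {l : ℕ} (hl : l + 2 ≤ k₂) {j : ℕ} (hj : j ≤ k₂) :
    B (dualNoise B N G e l) (X j) = if j = l then 1 else 0 := by
  have htri := h.isTriangular hN
  have ho : ∀ k ≤ N, ∀ j ≤ N, modelRank N k₂ j < modelRank N k₂ k → B (e k) (X j) = 0 :=
    fun k hk j hj hjk => htri.noise_orthogonal hB hw hk hj hjk
  have hz : ∀ t, t ≤ N → t ≠ l → t ≠ l + 1 → t ≠ N → B (dualNoise B N G e l) (e t) = 0 := by
    intro t ht h1 h2 h3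
    rw [dualNoise_left hB, hw l (by omega) t ht h1.symm, hw (l + 1) (by omega) t ht h2.symm,
      hw N le_rfl t ht h3.symm]
    simp
  have hk : B (dualNoise B N G e l) (X k₂) = 0 := by
    rw [h.waypoint hN]
    exact hz _ hN.le (by omega) (by omega) (by omega)
  rcases hj.eq_or_lt with rfl | hj
  · rw [hk, if_neg (by omega)]
  have hlow : ∀ j ≤ l, B (dualNoise B N G e l) (X j) = if j = l then 1 else 0 := by
    intro j hjl
    rw [dualNoise_left hB, ho (l + 1) (by omega) j (by omega) (by unfold modelRank; grind),
      ho N le_rfl j (by omega) (by unfold modelRank; grind), mul_zero, mul_zero, sub_zero, sub_zero]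
    split_ifs with hjl'
    · rw [hjl', htri.noise_self hB ho (by omega), Matrix.nonsing_inv_mul _ (hu l (by omega))]
    · rw [ho l (by omega) j (by omega) (by unfold modelRank; grind), mul_zero]
  rcases Nat.lt_or_ge l j with hlj | hlj
  swap
  · exact hlow j hlj
  rw [if_neg (by omega)]
  -- At `l + 1` the contribution `(G (l + 1) l)ᵀ` of `X l` cancels against the `e (l + 1)` term.
  -- From then on the recursion only involves zero pairings.
  induction j, (show l + 1 ≤ j from hlj) using Nat.le_induction with
  | base =>
    rw [h.before hN hj, hB.add_right, hB.add_right, hB.smul_right, hB.smul_right, hk,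
      hlow l le_rfl, if_pos rfl, dualNoise_left hB, hw l (by omega) (l + 1) (by omega) (by omega),
      hw N le_rfl (l + 1) (by omega) (by omega), mul_assoc,
      Matrix.nonsing_inv_mul _ (hu (l + 1) (by omega))]
    simp
  | succ j hlj ih =>
    rw [h.before hN hj, hB.add_right, hB.add_right, hB.smul_right, hB.smul_right, hk,
      ih (by omega) (by omega) (by omega), hz (j + 1) (by omega) (by omega) (by omega) (by omega)]
    simp

/-- In the sum defining `X N` only `i = l` survives, and the `e N` term of `dualNoise` was chosen to
cancel it. -/
lemma IsModel.dualNoise_destination (h : IsModel N k₂ G e X) (hB : IsCovForm B)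
    (hN : k₂ < N) (hw : ∀ i ≤ N, ∀ j ≤ N, i ≠ j → B (e i) (e j) = 0)
    (hu : ∀ k ≤ N, IsUnit (B (e k) (e k)).det) {l : ℕ} (hl : l + 2 ≤ k₂) :
    B (dualNoise B N G e l) (X N) = 0 := by
  rw [h.destination hN, hB.add_right, hB.sum_right]
  have : ∀ i ∈ Finset.Icc 0 k₂, B (dualNoise B N G e l) (G N i • X i) =
      if i = l then (G N i)ᵀ else 0 := by
    intro i hi
    rw [hB.smul_right, h.dualNoise_apply hB hN hw hu hl (Finset.mem_Icc.1 hi).2]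
    split_ifs <;> simp
  rw [Finset.sum_congr rfl this, Finset.sum_ite_eq', if_pos (by simp; omega), dualNoise_left hB,
    hw l (by omega) N le_rfl (by omega), hw (l + 1) (by omega) N le_rfl (by omega),
    mul_assoc (G N l)ᵀ, Matrix.nonsing_inv_mul _ (hu N le_rfl)]
  simp

/-- Adding back the `X k₂` term leaves `X l` minus a multiple of `X (l - 1)`, or just `X 0` when `l
= 0`. -/
lemma IsModel.noise_add_mem_span (h : IsModel N k₂ G e X) (hN : k₂ < N) {l m : ℕ} (hl : l < k₂)
    (hlm : l ≤ m) :
    e l + G l k₂ • X k₂ ∈ Submodule.span (SqMat d) (X '' {i | i ≤ m ∨ i = N}) := by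
  have hmem : ∀ i ≤ m, X i ∈ Submodule.span (SqMat d) (X '' {i | i ≤ m ∨ i = N}) :=
    fun i hi => Submodule.subset_span ⟨i, Or.inl hi, rfl⟩
  cases l with
  | zero =>
    have : e 0 + G 0 k₂ • X k₂ = X 0 := by rw [h.initial (by omega) hN, add_comm]
    rw [this]
    exact hmem 0 hlm
  | succ l =>
    have : e (l + 1) + G (l + 1) k₂ • X k₂ = X (l + 1) - G (l + 1) l • X l := by
      rw [h.before hN hl]; abel
    rw [this]
    exact Submodule.sub_mem _ (hmem _ hlm) (Submodule.smul_mem _ _ (hmem _ (by omega)))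

/-- The three noises are replaced by their model equations. `X k₂` enters through all three, the
other `X j` with `l + 2 ≤ j < k₂` only through `e N`; hence the case distinction in `dualCoeff`. -/
lemma IsModel.dualNoise_expansion (h : IsModel N k₂ G e X) (hN : k₂ < N) {l : ℕ}
    (hl : l + 2 ≤ k₂) :
    dualNoise B N G e l - ∑ j ∈ Finset.Icc (l + 2) k₂, dualCoeff B N k₂ G e l j • X j ∈
      Submodule.span (SqMat d) (X '' {i | i ≤ l + 1 ∨ i = N}) := by
  have hmem : ∀ i, (i ≤ l + 1 ∨ i = N) →
      X i ∈ Submodule.span (SqMat d) (X '' {i | i ≤ l + 1 ∨ i = N}) :=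
    fun i hi => Submodule.subset_span ⟨i, hi, rfl⟩
  have h1 := h.noise_add_mem_span hN (show l < k₂ by omega) (show l ≤ l + 1 by omega)
  have h2 := h.noise_add_mem_span hN (show l + 1 < k₂ by omega) (show l + 1 ≤ l + 1 by omega)
  have h3 : e N + ∑ j ∈ Finset.Icc (l + 2) k₂, G N j • X j ∈
      Submodule.span (SqMat d) (X '' {i | i ≤ l + 1 ∨ i = N}) := by
    have hs : ∑ i ∈ Finset.Icc 0 k₂, G N i • X i = ∑ i ∈ Finset.Icc 0 (l + 1), G N i • X i +
        ∑ i ∈ Finset.Icc (l + 2) k₂, G N i • X i := by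
      rw [← Finset.sum_union]
      · congr 1; ext i; simp; omega
      · rw [Finset.disjoint_left]; intro i; simp; omega
    have : e N + ∑ j ∈ Finset.Icc (l + 2) k₂, G N j • X j =
        X N - ∑ i ∈ Finset.Icc 0 (l + 1), G N i • X i := by
      rw [h.destination hN, hs]; abel
    rw [this]
    refine Submodule.sub_mem _ (hmem _ (Or.inr rfl)) (Submodule.sum_mem _ fun i hi =>
      Submodule.smul_mem _ _ (hmem _ (Or.inl (Finset.mem_Icc.1 hi).2)))
  have hc : ∑ j ∈ Finset.Icc (l + 2) k₂, dualCoeff B N k₂ G e l j • X j =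
      ((G N l)ᵀ * (B (e N) (e N))⁻¹) • ∑ j ∈ Finset.Icc (l + 2) k₂, G N j • X j +
      (((G (l + 1) l)ᵀ * (B (e (l + 1)) (e (l + 1)))⁻¹) • G (l + 1) k₂ • X k₂ -
        (B (e l) (e l))⁻¹ • G l k₂ • X k₂) := by
    simp only [dualCoeff, add_smul, Finset.sum_add_distrib, ite_smul, zero_smul,
      Finset.sum_ite_eq', Finset.mem_Icc, hl, le_refl, and_self, if_true, Finset.smul_sum,
      smul_smul, sub_smul]
  have := Submodule.sub_mem _ (Submodule.sub_mem _
    (Submodule.smul_mem _ (B (e l) (e l))⁻¹ h1)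
    (Submodule.smul_mem _ ((G (l + 1) l)ᵀ * (B (e (l + 1)) (e (l + 1)))⁻¹) h2))
    (Submodule.smul_mem _ ((G N l)ᵀ * (B (e N) (e N))⁻¹) h3)
  convert this using 1
  rw [hc, dualNoise]
  simp only [smul_add]
  abel

lemma IsModel.dualCoeff_eq_zero (h : IsModel N k₂ G e X) (hB : IsCovForm B)
    (hX : IsNondeg B N X) (hN : k₂ < N)
    (hw : ∀ i ≤ N, ∀ j ≤ N, i ≠ j → B (e i) (e j) = 0)
    (hstep : IsOneStep B X N) {l j : ℕ} (hlj : l + 2 ≤ j) (hj : j ≤ k₂) :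
    dualCoeff B N k₂ G e l j = 0 := by
  have hu : ∀ k ≤ N, IsUnit (B (e k) (e k)).det := fun k hk =>
    (h.isTriangular hN).isUnit_noise hB hX hk
  have hl : l + 2 ≤ k₂ := hlj.trans hj
  -- Descending induction on `j`: when `dualNoise` is paired with the residual `r` of `X j`, terms
  -- before `j` are orthogonal to `r` and terms after `j` already have zero coefficient.
  induction hn : k₂ - j using Nat.strong_induction_on generalizing j with
  | _ n ih =>
    obtain ⟨P, Q, hPQ⟩ := hstep j (by omega) (by omega)
    set r := X j - (P • X (j - 1) + Q • X N) with hr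
    have hp : P • X (j - 1) + Q • X N ∈ Submodule.span (SqMat d) (X '' {i | i < j ∨ i = N}) :=
      Submodule.add_mem _
        (Submodule.smul_mem _ _ (Submodule.subset_span ⟨j - 1, Or.inl (by omega), rfl⟩))
        (Submodule.smul_mem _ _ (Submodule.subset_span ⟨N, Or.inr rfl, rfl⟩))
    have hrr : B (X j) r = B r r := by
      conv_rhs => enter [1]; rw [hr]
      rw [hB.sub_left, hB.left_eq_zero_of_mem_span (fun i hi => hB.symm_eq_zero (hPQ i hi)) hp,
        sub_zero]
    have hunit : IsUnit (B r r).det :=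
      hX.isUnit_residual hB (by omega) (s := {i | i < j ∨ i = N})
        (fun t ht => by rcases ht with ht | rfl <;> omega)
        (fun hh => by rcases hh with hh | hh <;> omega) hp
    -- By the one-step property `r` involves only `X j`, `X (j - 1)` and `X N`, and `j - 1 > l`, so
    -- duality gives zero.
    have h0 : B (dualNoise B N G e l) r = 0 := by
      rw [hr, hB.sub_right, hB.add_right, hB.smul_right, hB.smul_right,
        h.dualNoise_apply hB hN hw hu hl hj,
        h.dualNoise_apply hB hN hw hu hl (show j - 1 ≤ k₂ by omega),
        h.dualNoise_destination hB hN hw hu hl, if_neg (by omega), if_neg (by omega)]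
      simp
    have h1 : B (dualNoise B N G e l -
        ∑ t ∈ Finset.Icc (l + 2) k₂, dualCoeff B N k₂ G e l t • X t) r = 0 := by
      refine hB.left_eq_zero_of_mem_span (fun i hi => hB.symm_eq_zero (hPQ i ?_))
        (h.dualNoise_expansion (B := B) hN hl)
      rcases hi with hi | hi
      · exact Or.inl (by omega)
      · exact Or.inr hi
    rw [hB.sub_left, h0, hB.sum_left, zero_sub, neg_eq_zero,
      Finset.sum_eq_single j] at h1
    · rw [hB.smul_left, hrr] at h1
      have := congrArg (· * (B r r)⁻¹) h1
      simpa [mul_assoc, Matrix.mul_nonsing_inv _ hunit] using this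
    · intro t ht htj
      rw [Finset.mem_Icc] at ht
      rw [hB.smul_left]
      rcases Nat.lt_or_ge t j with h2 | h2
      · rw [hB.symm_eq_zero (hPQ t (Or.inl h2)), mul_zero]
      · rw [ih (k₂ - t) (by omega) ht.1 ht.2 rfl, zero_mul]
    · intro hh
      exact absurd (Finset.mem_Icc.2 ⟨hlj, hj⟩) hh

lemma IsModel.isOneStep_waypoint (h : IsModel N k₂ G e X) (hB : IsCovForm B)
    (hN : k₂ < N) (hw : ∀ i ≤ N, ∀ j ≤ N, i ≠ j → B (e i) (e j) = 0) :
    IsOneStep B X k₂ := by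
  intro k hk hkm
  obtain ⟨k, rfl⟩ := Nat.exists_eq_add_of_le' hk
  refine ⟨G (k + 1) k, G (k + 1) k₂, fun i hi => ?_⟩
  have : X (k + 1) - (G (k + 1) k • X k + G (k + 1) k₂ • X k₂) = e (k + 1) := by
    rw [h.before hN hkm, add_sub_cancel_left]
  rw [Nat.add_sub_cancel, this]
  exact (h.isTriangular hN).noise_orthogonal hB hw (by omega) (by omega)
    (by unfold modelRank; grind)

lemma IsModel.isOneStep_destination (h : IsModel N k₂ G e X) (hB : IsCovForm B)
    (hX : IsNondeg B N X) (hN : k₂ < N)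
    (hw : ∀ i ≤ N, ∀ j ≤ N, i ≠ j → B (e i) (e j) = 0)
    (hc : ∀ l j, l + 2 ≤ j → j ≤ k₂ → dualCoeff B N k₂ G e l j = 0) :
    IsOneStep B X N := by
  have hu : ∀ k ≤ N, IsUnit (B (e k) (e k)).det := fun k hk =>
    (h.isTriangular hN).isUnit_noise hB hX hk
  intro k hk hkN
  rcases Nat.lt_or_ge k₂ k with hkk | hkk
  · refine ⟨G k (k - 1), G k N, fun i hi => ?_⟩
    have : X k - (G k (k - 1) • X (k - 1) + G k N • X N) = e k := by
      nth_rewrite 1 [h.after hkk hkN]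
      rw [add_sub_cancel_left]
    rw [this]
    exact (h.isTriangular hN).noise_orthogonal hB hw (by omega) (by omega)
      (by unfold modelRank; grind)
  have hs : ∀ t ∈ {i | i < k ∨ i = N}, t ≤ N := by
    rintro t (ht | rfl) <;> omega
  obtain ⟨p, hp, hpo⟩ := hX.exists_projection hB hs (X k)
  obtain ⟨C, hC, hpC⟩ := exists_coeff_of_mem_span hs hp
  -- `dualNoise` at `i` now lies in the span projected onto, so it is orthogonal to `X k - p`; by
  -- duality this pairing is `-(C i)ᵀ`.
  have hC0 : ∀ i, i + 2 ≤ k → C i = 0 := by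
    intro i hik
    have hz : dualNoise B N G e i ∈ Submodule.span (SqMat d) (X '' {t | t < k ∨ t = N}) := by
      have h1 := h.dualNoise_expansion (B := B) hN (show i + 2 ≤ k₂ by omega)
      rw [Finset.sum_eq_zero, sub_zero] at h1
      · refine span_image_mono X ?_ h1
        rintro t (ht | ht)
        · exact Or.inl (by omega)
        · exact Or.inr ht
      · intro j hj
        rw [Finset.mem_Icc] at hj
        rw [hc i j hj.1 hj.2, zero_smul]
    have h0 : B (dualNoise B N G e i) (X k - p) = 0 :=
      hB.left_eq_zero_of_mem_span (fun t ht => hB.symm_eq_zero (hpo t ht)) hz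
    rw [hB.sub_right, h.dualNoise_apply hB hN hw hu (by omega) hkk, if_neg (by omega),
      hpC, hB.sum_right, Finset.sum_eq_single i, hB.smul_right,
      h.dualNoise_apply hB hN hw hu (by omega) (by omega), if_pos rfl, one_mul, zero_sub,
      neg_eq_zero, transpose_eq_zero] at h0
    · exact h0
    · intro t ht hti
      rw [hB.smul_right]
      by_cases h1 : t < k
      · rw [h.dualNoise_apply hB hN hw hu (by omega) (by omega), if_neg hti, zero_mul]
      · by_cases h2 : t = N
        · rw [h2, h.dualNoise_destination hB hN hw hu (by omega), zero_mul]
        · rw [hC t (by rintro (h3 | h3) <;> contradiction), transpose_zero, mul_zero]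
    · intro hh
      exact absurd (Finset.mem_range.2 (by omega)) hh
  refine ⟨C (k - 1), C N, fun i hi => ?_⟩
  have : p = C (k - 1) • X (k - 1) + C N • X N := by
    rw [hpC, ← Finset.sum_subset (s₁ := {k - 1, N}), Finset.sum_pair (by omega)]
    · intro t ht
      rw [Finset.mem_insert, Finset.mem_singleton] at ht
      rw [Finset.mem_range]
      omega
    · intro t _ ht
      rw [Finset.mem_insert, Finset.mem_singleton, not_or] at ht
      by_cases h1 : t < k
      · rw [hC0 t (by omega), zero_smul]
      · rw [hC t (by rintro (h3 | h3); exacts [h1 h3, ht.2 h3]), zero_smul]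
  rw [← this]
  exact hpo i hi

/-- At times `0` and `N` the model allows every predecessor in the generating order, so a plain
projection suffices. The one-step properties are needed only before `k₂` (towards `k₂`) and after
`k₂` (towards `N`). -/
lemma exists_modelRhs_residual (hB : IsCovForm B) (hX : IsNondeg B N X) (hN : k₂ < N)
    (hstepN : IsOneStep B X N) (hstep : IsOneStep B X k₂) {k : ℕ} (hk : k ≤ N) :
    ∃ g : ℕ → SqMat d, ∀ j ≤ N, modelRank N k₂ j < modelRank N k₂ k →
      B (X k - modelRhs N k₂ g X k) (X j) = 0 := by
  by_cases h1 : k = k₂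
  · refine ⟨0, fun j _ hj => absurd hj ?_⟩
    unfold modelRank; grind
  by_cases h2 : k = N
  · have hs : ∀ t ∈ {i | i ≤ k₂}, t ≤ N := fun t ht => le_trans ht hN.le
    obtain ⟨p, hp, hpo⟩ := hX.exists_projection hB hs (X k)
    obtain ⟨C, hC⟩ := exists_coeff_of_mem_span (N := k₂) (fun t ht => ht) hp
    refine ⟨C, fun j hj hjk => ?_⟩
    have : modelRhs N k₂ C X k = p := by
      rw [modelRhs, if_neg h1, if_pos h2, hC.2]
      congr 1
      ext i; simp
    rw [this]
    refine hpo j ?_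
    change j ≤ k₂
    unfold modelRank at hjk
    grind
  by_cases h3 : k = 0
  · have hs : ∀ t ∈ ({k₂} : Set ℕ), t ≤ N := by rintro t rfl; exact hN.le
    obtain ⟨p, hp, hpo⟩ := hX.exists_projection hB hs (X k)
    rw [Set.image_singleton, Submodule.mem_span_singleton] at hp
    obtain ⟨A, rfl⟩ := hp
    refine ⟨fun _ => A, fun j hj hjk => ?_⟩
    rw [modelRhs, if_neg h1, if_neg h2, if_pos h3]
    refine hpo j ?_
    change j = k₂
    unfold modelRank at hjk
    grind
  by_cases h4 : k < k₂
  · obtain ⟨P, Q, hPQ⟩ := hstep k (by omega) h4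
    refine ⟨fun i => if i = k₂ then Q else P, fun j hj hjk => ?_⟩
    rw [modelRhs, if_neg h1, if_neg h2, if_neg h3, if_pos h4, if_pos rfl, if_neg (by omega)]
    refine hPQ j ?_
    unfold modelRank at hjk
    grind
  · obtain ⟨P, Q, hPQ⟩ := hstepN k (by omega) (by omega)
    refine ⟨fun i => if i = N then Q else P, fun j hj hjk => ?_⟩
    rw [modelRhs, if_neg h1, if_neg h2, if_neg h3, if_neg h4, if_pos rfl, if_neg (by omega)]
    refine hPQ j ?_
    unfold modelRank at hjk
    grind

lemma exists_isModel (hB : IsCovForm B) (hX : IsNondeg B N X) (hN : k₂ < N)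
    (hstepN : IsOneStep B X N) (hstep : IsOneStep B X k₂) :
    ∃ (G : ℕ → ℕ → SqMat d) (e : ℕ → E), IsModel N k₂ G e X ∧
      ∀ i ≤ N, ∀ j ≤ N, i ≠ j → B (e i) (e j) = 0 := by
  have : ∀ k, ∃ g : ℕ → SqMat d, k ≤ N → ∀ j ≤ N, modelRank N k₂ j < modelRank N k₂ k →
      B (X k - modelRhs N k₂ g X k) (X j) = 0 := fun k => by
    by_cases hk : k ≤ N
    · obtain ⟨g, hg⟩ := exists_modelRhs_residual hB hX hN hstepN hstep hk
      exact ⟨g, fun _ => hg⟩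
    · exact ⟨0, fun h => absurd h hk⟩
  choose G hG using this
  have hm : IsModel N k₂ G (fun k => X k - modelRhs N k₂ (G k) X k) X :=
    fun k _ => (add_sub_cancel _ _).symm
  exact ⟨G, _, hm, (hm.isTriangular hN).white hB (fun i hi j hj => modelRank_injOn hN hi hj) hG⟩

end Model

/-- The vanishing of the dual coefficients, as the parameter conditions of the model. -/
lemma dualCoeff_eq_zero_iff {d N k₂ : ℕ} {E : Type*} {B : E → E → SqMat d} {e : ℕ → E}
    {G : ℕ → ℕ → SqMat d} :
    (∀ l j, l + 2 ≤ j → j ≤ k₂ → dualCoeff B N k₂ G e l j = 0) ↔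
      (∀ j i, j + 2 ≤ i → i < k₂ → (G N j)ᵀ * (B (e N) (e N))⁻¹ * G N i = 0) ∧
      ∀ l, l + 2 ≤ k₂ → (B (e l) (e l))⁻¹ * G l k₂ =
        (G (l + 1) l)ᵀ * (B (e (l + 1)) (e (l + 1)))⁻¹ * G (l + 1) k₂ +
          (G N l)ᵀ * (B (e N) (e N))⁻¹ * G N k₂ := by
  constructor
  · refine fun h => ⟨fun j i hij hi => ?_, fun l hl => ?_⟩
    · have := h j i hij hi.le
      rwa [dualCoeff, if_neg hi.ne, add_zero] at this
    · have := h l k₂ hl le_rfl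
      rw [dualCoeff, if_pos rfl, ← add_sub_assoc, sub_eq_zero] at this
      rw [← this, add_comm]
  · rintro ⟨h1, h2⟩ l j hlj hj
    rcases hj.eq_or_lt with rfl | hj
    · rw [dualCoeff, if_pos rfl, h2 l hlj]
      abel
    · rw [dualCoeff, if_neg hj.ne, h1 l j hlj hj, add_zero]

/-! ### Conditional expectations and independence. -/

/-- Simple approximation of a measurable function, inside a class of functions that contains the
indicators and is stable under addition. -/
lemma exists_simple_approx {α : Type*} {mα : MeasurableSpace α} {f : α → ℝ} (hf : Measurable f)
    (p : (α → ℝ) → Prop) (hp : ∀ c A, MeasurableSet A → p (A.indicator fun _ => c))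
    (hadd : ∀ s t, p s → p t → p (s + t)) :
    ∃ fs : ℕ → α → ℝ, (∀ n, p (fs n)) ∧ (∀ n x, ‖fs n x‖ ≤ ‖f x‖ + ‖f x‖) ∧
      ∀ x, Tendsto (fun n => fs n x) atTop (nhds (f x)) := by
  classical
  have hs : ∀ s : SimpleFunc α ℝ, p s := by
    intro s
    induction s using SimpleFunc.induction with
    | const c hA =>
      rw [SimpleFunc.coe_piecewise, SimpleFunc.coe_const, SimpleFunc.const_zero,
        SimpleFunc.coe_zero, Set.piecewise_eq_indicator]
      exact hp c _ hA
    | add _ hs ht =>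
      rw [SimpleFunc.coe_add]
      exact hadd _ _ hs ht
  exact ⟨fun n => SimpleFunc.approxOn f hf Set.univ 0 trivial n, fun n => hs _,
    fun n x => SimpleFunc.norm_approxOn_zero_le hf _ x n,
    fun x => SimpleFunc.tendsto_approxOn hf _ (by simp)⟩

section CondExp

variable {Ω : Type*} {m₁ m₂ m₃ mΩ : MeasurableSpace Ω} {μ : Measure Ω} [IsFiniteMeasure μ]

lemma condExp_ae_eq_of_tendsto (h₁ : m₁ ≤ mΩ) (h₂ : m₂ ≤ mΩ) {fs : ℕ → Ω → ℝ} {f g : Ω → ℝ}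
    (hfs : ∀ n, Integrable (fs n) μ) (hg : Integrable g μ) (hbound : ∀ n x, ‖fs n x‖ ≤ g x)
    (hlim : ∀ x, Tendsto (fun n => fs n x) atTop (nhds (f x)))
    (heq : ∀ n, μ[fs n | m₁] =ᵐ[μ] μ[fs n | m₂]) : μ[f | m₁] =ᵐ[μ] μ[f | m₂] := by
  have hb : ∀ n, ∀ᵐ x ∂μ, ‖fs n x‖ ≤ g x := fun n => ae_of_all _ (hbound n)
  have t₁ := tendsto_condExpL1_of_dominated_convergence h₁ g (fun n => (hfs n).1) hg hb
    (ae_of_all _ hlim)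
  have t₂ := tendsto_condExpL1_of_dominated_convergence h₂ g (fun n => (hfs n).1) hg hb
    (ae_of_all _ hlim)
  have hn : ∀ n, condExpL1 h₁ μ (fs n) = condExpL1 h₂ μ (fs n) := fun n => by
    rw [Lp.ext_iff]
    exact (condExp_ae_eq_condExpL1 h₁ _).symm.trans
      ((heq n).trans (condExp_ae_eq_condExpL1 h₂ _))
  have := tendsto_nhds_unique t₁ (by simpa only [hn] using t₂)
  exact (condExp_ae_eq_condExpL1 h₁ _).trans (this ▸ (condExp_ae_eq_condExpL1 h₂ _).symm)

/-- If the conditional probabilities of all events of `m₃` agree, then so do the conditional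
expectations of all integrable `m₃`-measurable functions. -/
lemma condExp_ae_eq_of_condProb (h₁ : m₁ ≤ mΩ) (h₂ : m₂ ≤ mΩ) (h₃ : m₃ ≤ mΩ)
    (h : ∀ A, MeasurableSet[m₃] A → μ⟦A | m₁⟧ =ᵐ[μ] μ⟦A | m₂⟧) {f : Ω → ℝ}
    (hf : Measurable[m₃] f) (hfi : Integrable f μ) : μ[f | m₁] =ᵐ[μ] μ[f | m₂] := by
  obtain ⟨fs, hfs, hb, hlim⟩ := exists_simple_approx hf
    (fun s => Integrable s μ ∧ μ[s | m₁] =ᵐ[μ] μ[s | m₂])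
    (fun c A hA => by
      have hint : Integrable (A.indicator fun _ => (1 : ℝ)) μ :=
        (integrable_const 1).indicator (h₃ _ hA)
      have heq : (A.indicator fun _ => c) = c • A.indicator fun _ => (1 : ℝ) := by
        ext x
        by_cases hx : x ∈ A <;> simp [hx]
      rw [heq]
      exact ⟨hint.smul c, (condExp_smul c _ m₁).trans
        (((h A hA).const_smul c).trans (condExp_smul c _ m₂).symm)⟩)
    (fun s t hs ht => ⟨hs.1.add ht.1, (condExp_add hs.1 ht.1 m₁).trans
        ((hs.2.add ht.2).trans (condExp_add hs.1 ht.1 m₂).symm)⟩)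
  exact condExp_ae_eq_of_tendsto h₁ h₂ (fun n => (hfs n).1) (hfi.norm.add hfi.norm) hb hlim
    (fun n => (hfs n).2)

/-- Conditioning an event that depends on `m₂` and on information independent of `m₁ ≥ m₂`. -/
lemma condProb_ae_eq_of_indep (h₁ : m₁ ≤ mΩ) (h₂₁ : m₂ ≤ m₁) (h₃ : m₃ ≤ mΩ)
    (hind : Indep m₃ m₁ μ) {A : Set Ω} (hA : MeasurableSet[m₃ ⊔ m₂] A) :
    μ⟦A | m₁⟧ =ᵐ[μ] μ⟦A | m₂⟧ := by
  have h₂ : m₂ ≤ mΩ := h₂₁.trans h₁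
  have hsup : m₃ ⊔ m₂ ≤ mΩ := sup_le h₃ h₂
  set S : Set (Set Ω) := {u | ∃ a b, MeasurableSet[m₃] a ∧ MeasurableSet[m₂] b ∧ u = a ∩ b}
  have hgen : m₃ ⊔ m₂ = MeasurableSpace.generateFrom S := by
    apply le_antisymm
    · refine sup_le (fun a ha => ?_) (fun b hb => ?_)
      · exact MeasurableSpace.measurableSet_generateFrom ⟨a, Set.univ, ha, .univ, by simp⟩
      · exact MeasurableSpace.measurableSet_generateFrom ⟨Set.univ, b, .univ, hb, by simp⟩
    · refine MeasurableSpace.generateFrom_le ?_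
      rintro _ ⟨a, b, ha, hb, rfl⟩
      exact MeasurableSet.inter ((le_sup_left : m₃ ≤ m₃ ⊔ m₂) a ha)
        ((le_sup_right : m₂ ≤ m₃ ⊔ m₂) b hb)
  have hpi : IsPiSystem S := by
    rintro _ ⟨a, b, ha, hb, rfl⟩ _ ⟨a', b', ha', hb', rfl⟩ _
    exact ⟨a ∩ a', b ∩ b', ha.inter ha', hb.inter hb', Set.inter_inter_inter_comm a b a' b'⟩
  have hi : ∀ A, MeasurableSet[m₃ ⊔ m₂] A → Integrable (A.indicator fun _ => (1 : ℝ)) μ :=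
    fun A hA => (integrable_const 1).indicator (hsup _ hA)
  induction A, hA using MeasurableSpace.induction_on_inter hgen hpi with
  | empty => simp
  | basic t ht =>
    obtain ⟨a, b, ha, hb, rfl⟩ := ht
    -- On a generating rectangle both conditional probabilities equal the indicator of `b` times
    -- `P(a)`, which does not depend on the conditioning σ-algebra.
    have key : ∀ m, m ≤ mΩ → Indep m₃ m μ → MeasurableSet[m] b →
        μ⟦a ∩ b | m⟧ =ᵐ[μ] b.indicator fun _ => ∫ x, a.indicator (fun _ => (1 : ℝ)) x ∂μ := by
      intro m hm hmi hbm
      have h1 : (a ∩ b).indicator (fun _ => (1 : ℝ)) =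
          b.indicator (a.indicator fun _ => (1 : ℝ)) := by
        rw [Set.indicator_indicator, Set.inter_comm]
      rw [h1]
      refine (condExp_indicator ((integrable_const 1).indicator (h₃ _ ha)) hbm).trans ?_
      have h2 : μ[a.indicator (fun _ => (1 : ℝ)) | m] =ᵐ[μ]
          fun _ => ∫ x, a.indicator (fun _ => (1 : ℝ)) x ∂μ :=
        condExp_indep_eq h₃ hm
          ((@stronglyMeasurable_const _ _ m₃ _ (1 : ℝ)).indicator ha) hmi
      filter_upwards [h2] with x hx
      by_cases hxb : x ∈ b <;> simp [hxb, hx]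
    exact (key m₁ h₁ hind (h₂₁ _ hb)).trans
      (key m₂ h₂ (indep_of_indep_of_le_right hind h₂₁) hb).symm
  | compl t ht ih =>
    have h1 : tᶜ.indicator (fun _ => (1 : ℝ)) = (fun _ => (1 : ℝ)) - t.indicator fun _ => 1 := by
      rw [Set.indicator_compl]
    rw [h1]
    refine (condExp_sub (integrable_const _) (hi t ht) m₁).trans (EventuallyEq.trans ?_
      (condExp_sub (integrable_const _) (hi t ht) m₂).symm)
    rw [condExp_const h₁, condExp_const h₂]
    exact EventuallyEq.rfl.sub ih
  | iUnion f hd hf ih =>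
    refine condExp_ae_eq_of_tendsto h₁ h₂
      (fs := fun n => ∑ i ∈ Finset.range n, (f i).indicator fun _ => (1 : ℝ))
      (g := fun _ => 1) (fun n => ?_) (integrable_const _) (fun n x => ?_) (fun x => ?_)
      (fun n => ?_)
    · exact integrable_finsetSum' _ fun i _ => hi _ (hf i)
    · rw [Finset.sum_apply, ← Finset.indicator_biUnion_apply _ _
        (fun i _ j _ hij => hd hij)]
      exact (norm_indicator_le_norm_self _ _).trans (by simp)
    · have := ((tendsto_indicator_biUnion_finset f (fun _ => (1 : ℝ)) x).mono_right
        (pure_le_nhds _)).comp tendsto_finset_range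
      refine this.congr fun n => ?_
      rw [Function.comp_apply, Finset.sum_apply, Finset.indicator_biUnion_apply _ _
        (fun i _ j _ hij => hd hij)]
    · refine (condExp_finsetSum (fun i _ => hi _ (hf i)) m₁).trans (EventuallyEq.trans ?_
        (condExp_finsetSum (fun i _ => hi _ (hf i)) m₂).symm)
      exact eventuallyEq_sum fun i _ => ih i

end CondExp

lemma sigmaOf_le {Ω : Type*} {d : ℕ} {m : MeasurableSpace Ω} {X : ℕ → Ω → Fin d → ℝ} {s : Set ℕ}
    (h : ∀ i ∈ s, Measurable[m] (X i)) : sigmaOf X s ≤ m :=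
  iSup₂_le fun i hi => (h i hi).comap_le

lemma measurable_sigmaOf {Ω : Type*} {d : ℕ} {X : ℕ → Ω → Fin d → ℝ} {s : Set ℕ} {i : ℕ} (hi : i ∈ s) :
    Measurable[sigmaOf X s] (X i) :=
  Measurable.of_comap_le (le_iSup₂_of_le i hi le_rfl)

/-! ### Gaussian sequences in the module of square-integrable vectors. -/

section Concrete

open scoped Matrix.Module

variable {Ω : Type*} [MeasurableSpace Ω] {μ : Measure Ω} {d N : ℕ}

lemma covariance_congr_ae {f g f' g' : Ω → ℝ} (hf : f =ᵐ[μ] f') (hg : g =ᵐ[μ] g') :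
    cov[f, g; μ] = cov[f', g'; μ] := by
  unfold covariance
  rw [integral_congr_ae hf, integral_congr_ae hg]
  refine integral_congr_ae ?_
  filter_upwards [hf, hg] with ω h1 h2
  rw [h1, h2]

/-- The square-integrable random vectors, as a module over the square matrices. -/
def sqIntegrable (μ : Measure Ω) (d : ℕ) : Submodule (SqMat d) (Ω → Fin d → ℝ) where
  carrier := {Y | ∀ a, MemLp (fun ω => Y ω a) 2 μ}
  add_mem' hY hZ a := (hY a).add (hZ a)
  zero_mem' _ := MemLp.zero
  smul_mem' A _ hY a := memLp_finsetSum _ fun b _ => (hY b).const_mul (A a b)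

/-- The cross-covariance of square-integrable random vectors. -/
noncomputable def covForm (μ : Measure Ω) (d : ℕ) (Y Z : sqIntegrable μ d) : SqMat d :=
  crossCov μ (Y : Ω → Fin d → ℝ) (Z : Ω → Fin d → ℝ)

lemma isCovForm_covForm [IsFiniteMeasure μ] : IsCovForm (covForm μ d) where
  add_left x y z := by
    ext a b
    exact covariance_add_left (x.2 a) (y.2 a) (z.2 b)
  smul_left A y z := by
    ext a b
    have : cov[fun ω => ∑ c, A a c * y.1 ω c, fun ω => z.1 ω b; μ] =
        ∑ c, A a c * cov[fun ω => y.1 ω c, fun ω => z.1 ω b; μ] := by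
      rw [covariance_fun_sum_left (fun c => (y.2 c).const_mul (A a c)) (z.2 b)]
      simp_rw [covariance_const_mul_left]
    exact this
  symm y z := by
    ext a b
    exact covariance_comm _ _

/-- Elements here are functions, not classes, and are not centred, so the form is not definite. Zero
variance still makes each coordinate almost surely constant, hence uncorrelated with everything. -/
lemma covForm_eq_zero_of_self [IsProbabilityMeasure μ] {y : sqIntegrable μ d}
    (h : covForm μ d y y = 0) (z : sqIntegrable μ d) : covForm μ d y z = 0 := by
  ext a b
  have h1 : Var[fun ω => y.1 ω a; μ] = 0 := by
    rw [← covariance_self (y.2 a).aemeasurable]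
    exact congrFun (congrFun h a) a
  have h2 : (fun ω => y.1 ω a) =ᵐ[μ] fun _ => ∫ ω, y.1 ω a ∂μ :=
    ae_eq_integral_of_variance_eq_zero (y.2 a) h1
  change cov[fun ω => y.1 ω a, fun ω => z.1 ω b; μ] = 0
  rw [covariance_congr_ae h2 EventuallyEq.rfl, covariance_const_left]

lemma IsZMNG.mem_sqIntegrable {X : ℕ → Ω → Fin d → ℝ} (hX : IsZMNG μ N X) {k : ℕ} (hk : k ≤ N) :
    X k ∈ sqIntegrable μ d := fun a =>
  ((hX.gaussian.eval ⟨k, Nat.lt_succ_of_le hk⟩).eval a).memLp_two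

lemma crossCov_congr {Y Z Y' Z' : Ω → Fin d → ℝ} (hY : Y =ᵐ[μ] Y') (hZ : Z =ᵐ[μ] Z') :
    crossCov μ Y Z = crossCov μ Y' Z' := by
  ext a b
  exact covariance_congr_ae (hY.mono fun ω h => congrFun h a) (hZ.mono fun ω h => congrFun h b)

lemma IsZMNG.congr {X Y : ℕ → Ω → Fin d → ℝ} (hX : IsZMNG μ N X)
    (h : ∀ k ≤ N, X k =ᵐ[μ] Y k) : IsZMNG μ N Y where
  gaussian := by
    refine hX.gaussian.congr ?_
    have : ∀ᵐ ω ∂μ, ∀ k : Fin (N + 1), X k ω = Y k ω :=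
      ae_all_iff.2 fun k => h k (Nat.le_of_lt_succ k.2)
    filter_upwards [this] with ω hω
    exact funext hω
  mean_zero k hk a := by
    rw [← hX.mean_zero k hk a]
    exact integral_congr_ae ((h k hk).mono fun ω hω => (congrFun hω a).symm)
  nonsingular := by
    have : seqCov μ N Y = seqCov μ N X := by
      ext p q
      exact congrFun (congrFun (crossCov_congr (h _ (Nat.le_of_lt_succ p.1.2))
        (h _ (Nat.le_of_lt_succ q.1.2))).symm p.2) q.2
    rw [this]
    exact hX.nonsingular

lemma IsZMNG.isNondeg [IsProbabilityMeasure μ] {X : ℕ → sqIntegrable μ d}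
    (hX : IsZMNG μ N fun k => (X k : Ω → Fin d → ℝ)) : IsNondeg (covForm μ d) N X := by
  intro C hC j hj
  have hB := isCovForm_covForm (μ := μ) (d := d)
  have h0 : ∀ i, ∑ t ∈ Finset.range (N + 1), C t * covForm μ d (X t) (X i) = 0 := by
    intro i
    have := covForm_eq_zero_of_self hC (X i)
    rw [hB.sum_left] at this
    simpa only [hB.smul_left] using this
  ext b a
  -- The `b`-th rows of the matrices `C j`, stacked, form a left null vector of the full covariance
  -- matrix.
  have hv : (fun p : Fin (N + 1) × Fin d => C p.1 b p.2) ᵥ*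
      seqCov μ N (fun k => (X k : Ω → Fin d → ℝ)) = 0 := by
    ext q
    have := congrFun (congrFun (h0 q.1) b) q.2
    rw [Finset.sum_range, Matrix.sum_apply] at this
    simp only [Matrix.mul_apply] at this
    rw [Matrix.vecMul, dotProduct, Fintype.sum_prod_type]
    exact this
  have := Matrix.eq_zero_of_vecMul_eq_zero hX.nonsingular.ne_zero hv
  exact congrFun this (⟨j, Nat.lt_succ_of_le hj⟩, a)

/-- A combination of `X 0, …, X N` is a linear function of the whole sequence. -/
lemma exists_linearMap_of_mem_span {X : ℕ → sqIntegrable μ d} {y : sqIntegrable μ d}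
    {s : Set ℕ} (hs : ∀ t ∈ s, t ≤ N) (hy : y ∈ Submodule.span (SqMat d) (X '' s)) :
    ∃ L : (Fin (N + 1) → Fin d → ℝ) →ₗ[ℝ] (Fin d → ℝ),
      ∀ ω, y.1 ω = L fun k => (X k).1 ω := by
  obtain ⟨C, -, rfl⟩ := exists_coeff_of_mem_span hs hy
  refine ⟨∑ t : Fin (N + 1), (C t).mulVecLin ∘ₗ LinearMap.proj t, fun ω => ?_⟩
  rw [Finset.sum_range, Submodule.coe_sum, Finset.sum_apply, LinearMap.sum_apply]
  rfl

lemma HasGaussianLaw.of_linearMap {F : Type*} [NormedAddCommGroup F] [NormedSpace ℝ F]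
    [MeasurableSpace F] [BorelSpace F] {X : ℕ → Ω → Fin d → ℝ}
    (hX : HasGaussianLaw (fun ω (k : Fin (N + 1)) => X k ω) μ) {Y : Ω → F}
    (L : (Fin (N + 1) → Fin d → ℝ) →ₗ[ℝ] F) (hL : ∀ ω, Y ω = L fun k => X k ω) :
    HasGaussianLaw Y μ := by
  have h1 := hX.map_fun L.toContinuousLinearMap
  have h2 : Y = fun ω => L.toContinuousLinearMap fun k => X k ω := funext hL
  rw [h2]
  exact h1

lemma IsZMNG.integral_linearMap {X : ℕ → Ω → Fin d → ℝ} (hX : IsZMNG μ N X)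
    (L : (Fin (N + 1) → Fin d → ℝ) →ₗ[ℝ] (Fin d → ℝ)) (a : Fin d) :
    ∫ ω, L (fun k => X k ω) a ∂μ = 0 := by
  have hi := hX.gaussian.integrable
  have h0 : ∫ ω, (fun k : Fin (N + 1) => X k ω) ∂μ = 0 := by
    ext k b
    rw [eval_integral fun k => hi.eval k, eval_integral fun b => (hi.eval k).eval b]
    exact hX.mean_zero k (Nat.le_of_lt_succ k.2) b
  have := (LinearMap.toContinuousLinearMap (LinearMap.proj a ∘ₗ L)).integral_comp_comm hi
  rw [h0, map_zero] at this
  exact this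

/-- A sequence that spans the same module as a ZMNG sequence is ZMNG. -/
lemma IsZMNG.of_span [IsProbabilityMeasure μ] {X Y : ℕ → sqIntegrable μ d}
    (hX : IsZMNG μ N fun k => (X k : Ω → Fin d → ℝ))
    (hYX : ∀ k ≤ N, Y k ∈ Submodule.span (SqMat d) (X '' Set.Iic N))
    (hXY : ∀ k ≤ N, X k ∈ Submodule.span (SqMat d) (Y '' Set.Iic N)) :
    IsZMNG μ N fun k => (Y k : Ω → Fin d → ℝ) where
  gaussian := by
    have : ∀ k : Fin (N + 1), ∃ L : (Fin (N + 1) → Fin d → ℝ) →ₗ[ℝ] (Fin d → ℝ),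
        ∀ ω, (Y k).1 ω = L fun k => (X k).1 ω := fun k =>
      exists_linearMap_of_mem_span (fun _ h => h) (hYX k (Nat.le_of_lt_succ k.2))
    choose L hL using this
    exact HasGaussianLaw.of_linearMap (X := fun k => (X k).1) hX.gaussian (LinearMap.pi L)
      fun ω => funext fun k => hL k ω
  mean_zero k hk a := by
    obtain ⟨L, hL⟩ := exists_linearMap_of_mem_span (fun _ h => h) (hYX k hk)
    simp_rw [hL]
    exact hX.integral_linearMap L a
  nonsingular := by
    have : ∀ k, ∃ C : ℕ → SqMat d, k ≤ N → X k = ∑ t ∈ Finset.range (N + 1), C t • Y t :=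
      fun k => by
        by_cases hk : k ≤ N
        · obtain ⟨C, -, hC⟩ := exists_coeff_of_mem_span (fun _ h => h) (hXY k hk)
          exact ⟨C, fun _ => hC⟩
        · exact ⟨0, fun h => absurd h hk⟩
    choose C hC using this
    have hB := isCovForm_covForm (μ := μ) (d := d)
    -- Stacked, `X` is `T` applied to `Y`, so `Cov(X) = T Cov(Y) Tᵀ`, and nonsingularity passes to
    -- the factor `Cov(Y)`.
    set T : Matrix (Fin (N + 1) × Fin d) (Fin (N + 1) × Fin d) ℝ :=
      Matrix.of fun p q => C p.1 q.1 p.2 q.2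
    have hcov : seqCov μ N (fun k => (X k : Ω → Fin d → ℝ)) =
        T * seqCov μ N (fun k => (Y k : Ω → Fin d → ℝ)) * Tᵀ := by
      ext p q
      have h1 : covForm μ d (X p.1) (X q.1) = ∑ u : Fin (N + 1), ∑ t : Fin (N + 1),
          C p.1 t * covForm μ d (Y t) (Y u) * (C q.1 u)ᵀ := by
        rw [hC _ (Nat.le_of_lt_succ p.1.2), hC _ (Nat.le_of_lt_succ q.1.2), Finset.sum_range,
          Finset.sum_range, hB.sum_right]
        refine Finset.sum_congr rfl fun u _ => ?_
        rw [hB.sum_left]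
        refine Finset.sum_congr rfl fun t _ => ?_
        rw [hB.smul_left, hB.smul_right, mul_assoc]
      have h2 := congrFun (congrFun h1 p.2) q.2
      simp only [Matrix.sum_apply, Matrix.mul_apply, Matrix.transpose_apply] at h2
      simp only [Matrix.mul_apply, Matrix.transpose_apply, Fintype.sum_prod_type]
      refine h2.trans (Finset.sum_congr rfl fun u _ => ?_)
      rw [Finset.sum_comm]
      refine Finset.sum_congr rfl fun c _ => ?_
      rw [Finset.sum_mul]
      rfl
    have hdet := hX.nonsingular
    rw [hcov, Matrix.det_mul, Matrix.det_mul] at hdet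
    exact isUnit_of_mul_isUnit_right (isUnit_of_mul_isUnit_left hdet)

lemma measurable_of_mem_span {X : ℕ → sqIntegrable μ d} {s : Set ℕ}
    {y : sqIntegrable μ d} {m : MeasurableSpace Ω} (h : ∀ i ∈ s, Measurable[m] (X i : Ω → Fin d → ℝ))
    (hy : y ∈ Submodule.span (SqMat d) (X '' s)) : Measurable[m] (y : Ω → Fin d → ℝ) := by
  induction hy using Submodule.span_induction with
  | mem x hx =>
    obtain ⟨i, hi, rfl⟩ := hx
    exact h i hi
  | zero => exact measurable_const
  | add x y _ _ hx hy => exact hx.add hy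
  | smul A x _ hx =>
    refine measurable_pi_lambda _ fun a => ?_
    change Measurable[m] fun ω => ∑ b, A a b * x.1 ω b
    exact Finset.measurable_sum _ fun b _ => ((measurable_pi_apply b).comp hx).const_mul (A a b)

/-- Uncorrelated combinations of a Gaussian sequence are independent. -/
lemma IsZMNG.indep_sigmaOf {X Y Z : ℕ → sqIntegrable μ d}
    (hX : IsZMNG μ N fun k => (X k : Ω → Fin d → ℝ)) {s t : Set ℕ} (hs : s.Finite) (ht : t.Finite)
    (hY : ∀ i ∈ s, Y i ∈ Submodule.span (SqMat d) (X '' Set.Iic N))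
    (hZ : ∀ i ∈ t, Z i ∈ Submodule.span (SqMat d) (X '' Set.Iic N))
    (h : ∀ i ∈ s, ∀ j ∈ t, covForm μ d (Y i) (Z j) = 0) :
    Indep (sigmaOf (fun k => (Y k : Ω → Fin d → ℝ)) s)
      (sigmaOf (fun k => (Z k : Ω → Fin d → ℝ)) t) μ := by
  have := hs.to_subtype
  have := ht.to_subtype
  have hLY : ∀ i : s, ∃ L : (Fin (N + 1) → Fin d → ℝ) →ₗ[ℝ] (Fin d → ℝ),
      ∀ ω, (Y i).1 ω = L fun k => (X k).1 ω := fun i =>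
    exists_linearMap_of_mem_span (fun _ h => h) (hY i i.2)
  have hLZ : ∀ i : t, ∃ L : (Fin (N + 1) → Fin d → ℝ) →ₗ[ℝ] (Fin d → ℝ),
      ∀ ω, (Z i).1 ω = L fun k => (X k).1 ω := fun i =>
    exists_linearMap_of_mem_span (fun _ h => h) (hZ i i.2)
  choose LY hLY using hLY
  choose LZ hLZ using hLZ
  let := Fintype.ofFinite s
  let := Fintype.ofFinite t
  have hg : HasGaussianLaw (fun ω => ((fun p : s × Fin d => (Y p.1).1 ω p.2),
      (fun p : t × Fin d => (Z p.1).1 ω p.2))) μ := by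
    refine HasGaussianLaw.of_linearMap (X := fun k => (X k).1) hX.gaussian
      ((LinearMap.pi fun p : s × Fin d => LinearMap.proj p.2 ∘ₗ LY p.1).prod
        (LinearMap.pi fun p : t × Fin d => LinearMap.proj p.2 ∘ₗ LZ p.1)) fun ω => ?_
    ext p
    · exact congrFun (hLY p.1 ω) p.2
    · exact congrFun (hLZ p.1 ω) p.2
  have hind := HasGaussianLaw.indepFun_of_covariance_eval hg
    fun p q => congrFun (congrFun (h p.1 p.1.2 q.1 q.1.2) p.2) q.2
  refine indep_of_indep_of_le_left (indep_of_indep_of_le_right hind ?_) ?_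
  · refine sigmaOf_le fun i hi => ?_
    refine @measurable_pi_lambda _ _ _ (_) _ _ fun a => ?_
    exact (measurable_pi_apply (X := fun _ : t × Fin d => ℝ) (⟨i, hi⟩, a)).comp
      (comap_measurable fun ω (p : t × Fin d) => (Z p.1).1 ω p.2)
  · refine sigmaOf_le fun i hi => ?_
    refine @measurable_pi_lambda _ _ _ (_) _ _ fun a => ?_
    exact (measurable_pi_apply (X := fun _ : s × Fin d => ℝ) (⟨i, hi⟩, a)).comp
      (comap_measurable fun ω (p : s × Fin d) => (Y p.1).1 ω p.2)

end Concrete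

/-! ### The conditional Markov property as one-step regression. -/

section Markov

open scoped Matrix.Module

lemma IsZMNG.integral_eq_zero {Ω : Type*} {mΩ : MeasurableSpace Ω} {μ : Measure Ω} {d N : ℕ}
    {X : ℕ → sqIntegrable μ d} (hX : IsZMNG μ N fun k => (X k : Ω → Fin d → ℝ))
    {s : Set ℕ} (hs : ∀ t ∈ s, t ≤ N) {y : sqIntegrable μ d}
    (hy : y ∈ Submodule.span (SqMat d) (X '' s)) (a : Fin d) : ∫ ω, y.1 ω a ∂μ = 0 := by
  obtain ⟨L, hL⟩ := exists_linearMap_of_mem_span hs hy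
  simp_rw [hL]
  exact hX.integral_linearMap L a

variable {Ω : Type*} {mΩ : MeasurableSpace Ω} {μ : Measure Ω} [IsProbabilityMeasure μ] {d N : ℕ}
  {X : ℕ → sqIntegrable μ d}

lemma IsZMNG.covForm_apply (hX : IsZMNG μ N fun k => (X k : Ω → Fin d → ℝ))
    (y : sqIntegrable μ d) {i : ℕ} (hi : i ≤ N) (a b : Fin d) :
    covForm μ d y (X i) a b = ∫ ω, y.1 ω a * (X i).1 ω b ∂μ := by
  have := covariance_eq_sub (y.2 a) ((X i).2 b)
  rw [hX.mean_zero i hi b, mul_zero, sub_zero] at this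
  exact this

/-- Project `X k` onto `X (k - 1)` and `X m`. The residual is independent of these two, so its
conditional mean given them is zero. The Markov property at time `k - 1` carries this over to the
whole past, which gives orthogonality to the past. -/
lemma IsZMNG.isOneStep_of_isCML (hX : IsZMNG μ N fun k => (X k : Ω → Fin d → ℝ))
    (hm : ∀ k ≤ N, Measurable (X k : Ω → Fin d → ℝ)) {m : ℕ} (hmN : m ≤ N)
    (h : IsCML μ (fun k => (X k : Ω → Fin d → ℝ)) 0 m) : IsOneStep (covForm μ d) X m := by
  have hB := isCovForm_covForm (μ := μ) (d := d)
  intro k hk hkm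
  have hs : ∀ t ∈ ({k - 1, m} : Set ℕ), t ≤ N := by
    rintro t (rfl | rfl) <;> omega
  obtain ⟨p, hp, hpo⟩ := hX.isNondeg.exists_projection hB hs (X k)
  have hp' := hp
  rw [Set.image_pair, Submodule.mem_span_pair] at hp'
  obtain ⟨P, Q, hPQ⟩ := hp'
  refine ⟨P, Q, fun i hi => ?_⟩
  rw [hPQ]
  set r := X k - p with hr
  set T₁ : Set ℕ := Set.Icc 0 (k - 1) ∪ {m}
  set T₃ : Set ℕ := Set.Ioc (k - 1) m
  set Y : ℕ → Ω → Fin d → ℝ := fun k => X k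
  have hle₁ : sigmaOf Y T₁ ≤ mΩ := sigmaOf_le fun t ht => hm t (by
    rcases ht with ht | rfl
    · have := ht.2; omega
    · exact hmN)
  have hle₂ : sigmaOf Y {k - 1, m} ≤ mΩ := sigmaOf_le fun t ht => hm t (hs t ht)
  have hle₃ : sigmaOf Y T₃ ≤ mΩ := sigmaOf_le fun t ht => hm t (ht.2.trans hmN)
  have hle₂₁ : sigmaOf Y {k - 1, m} ≤ sigmaOf Y T₁ := sigmaOf_le fun t ht => measurable_sigmaOf (by
    rcases ht with rfl | rfl
    · exact Or.inl ⟨Nat.zero_le _, le_rfl⟩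
    · exact Or.inr rfl)
  have hrspan : r ∈ Submodule.span (SqMat d) (X '' Set.Iic N) :=
    Submodule.sub_mem _ (Submodule.subset_span ⟨k, by simp; omega, rfl⟩)
      (span_image_mono X hs hp)
  have hrmeas : Measurable r.1 := measurable_of_mem_span (fun i hi => hm i hi) hrspan
  have hind : Indep (MeasurableSpace.comap r.1 inferInstance) (sigmaOf Y {k - 1, m}) μ := by
    have := hX.indep_sigmaOf (Y := fun _ => r) (Z := X) (s := {0}) (t := {k - 1, m})
      (Set.finite_singleton _) (Set.toFinite _) (fun _ _ => hrspan)
      (fun t ht => Submodule.subset_span ⟨t, hs t ht, rfl⟩) (fun _ _ t ht => hpo t ht)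
    exact indep_of_indep_of_le_left this
      (measurable_sigmaOf (X := fun _ => r.1) (Set.mem_singleton 0)).comap_le
  have hr0 : ∀ a, μ[fun ω => r.1 ω a | sigmaOf Y T₁] =ᵐ[μ] 0 := by
    intro a
    have h0 : μ[fun ω => r.1 ω a | sigmaOf Y {k - 1, m}] =ᵐ[μ] 0 := by
      refine (condExp_indep_eq hrmeas.comap_le hle₂ (Measurable.stronglyMeasurable
        ((measurable_pi_apply a).comp (comap_measurable r.1))) hind).trans ?_
      exact ae_of_all _ fun _ => hX.integral_eq_zero (fun _ h => h) hrspan a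
    have hXi : Integrable (fun ω => (X k).1 ω a) μ := ((X k).2 a).integrable one_le_two
    have hpi : Integrable (fun ω => p.1 ω a) μ := (p.2 a).integrable one_le_two
    have heq : μ[fun ω => (X k).1 ω a | sigmaOf Y T₁] =ᵐ[μ] μ[fun ω => (X k).1 ω a | sigmaOf Y {k - 1, m}] :=
      condExp_ae_eq_of_condProb hle₁ hle₂ hle₃
        (fun A hA => h (k - 1) (Nat.zero_le _) (by omega) A hA)
        ((measurable_pi_apply a).comp (measurable_sigmaOf
          (X := fun k => (X k : Ω → Fin d → ℝ)) (s := Set.Ioc (k - 1) m) ⟨by omega, hkm.le⟩)) hXi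
    have hpm : Measurable[sigmaOf Y {k - 1, m}] fun ω => p.1 ω a :=
      (measurable_pi_apply a).comp
        (measurable_of_mem_span (fun i hi => measurable_sigmaOf hi) hp)
    have hp1 : μ[fun ω => p.1 ω a | sigmaOf Y T₁] = fun ω => p.1 ω a :=
      condExp_of_stronglyMeasurable hle₁ (hpm.mono hle₂₁ le_rfl).stronglyMeasurable hpi
    have hp2 : μ[fun ω => p.1 ω a | sigmaOf Y {k - 1, m}] = fun ω => p.1 ω a :=
      condExp_of_stronglyMeasurable hle₂ hpm.stronglyMeasurable hpi
    refine EventuallyEq.trans (condExp_sub hXi hpi (sigmaOf Y T₁)) (EventuallyEq.trans ?_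
      ((condExp_sub hXi hpi (sigmaOf Y {k - 1, m})).symm.trans h0))
    rw [hp1, hp2]
    exact heq.sub EventuallyEq.rfl
  have hiN : i ≤ N := by omega
  ext a b
  rw [hX.covForm_apply r hiN]
  have hXm : StronglyMeasurable[sigmaOf Y T₁] fun ω => (X i).1 ω b := by
    refine Measurable.stronglyMeasurable ((measurable_pi_apply b).comp (measurable_sigmaOf
      (X := fun k => (X k : Ω → Fin d → ℝ)) ?_))
    rcases hi with hi | hi
    · exact Or.inl ⟨Nat.zero_le _, by omega⟩
    · exact Or.inr hi
  have hprod : Integrable ((fun ω => r.1 ω a) * fun ω => (X i).1 ω b) μ :=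
    (r.2 a).integrable_mul ((X i).2 b)
  -- `X i` is known given the past and `X m`, so it pulls out; integrating then gives the
  -- covariance.
  have h1 : μ[(fun ω => r.1 ω a) * (fun ω => (X i).1 ω b) | sigmaOf Y T₁] =ᵐ[μ] 0 := by
    refine (condExp_mul_of_stronglyMeasurable_right hXm hprod
      ((r.2 a).integrable one_le_two)).trans ?_
    filter_upwards [hr0 a] with ω hω
    simp [hω]
  have h2 := integral_condExp (μ := μ) (f := (fun ω => r.1 ω a) * fun ω => (X i).1 ω b) hle₁
  rw [integral_congr_ae h1] at h2
  simpa using h2.symm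

/-- Iterating the one-step regressions. -/
lemma IsOneStep.exists_regression {E : Type*} [AddCommGroup E] [Module (SqMat d) E]
    {B : E → E → SqMat d} {X : ℕ → E} {m : ℕ} (h : IsOneStep B X m) (hB : IsCovForm B) {j : ℕ}
    {i : ℕ} (hji : j ≤ i) (him : i ≤ m) :
    ∃ p ∈ Submodule.span (SqMat d) (X '' {j, m}),
      ∀ t, (t ≤ j ∨ t = m) → B (X i - p) (X t) = 0 := by
  have hmem : X m ∈ Submodule.span (SqMat d) (X '' {j, m}) :=
    Submodule.subset_span ⟨m, by simp, rfl⟩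
  rcases him.eq_or_lt with rfl | him
  · exact ⟨X i, hmem, fun t _ => by rw [sub_self, hB.zero_left]⟩
  induction i, hji using Nat.le_induction with
  | base =>
    exact ⟨X j, Submodule.subset_span ⟨j, by simp, rfl⟩,
      fun t _ => by rw [sub_self, hB.zero_left]⟩
  | succ i hji ih =>
    obtain ⟨p, hp, hpo⟩ := ih (by omega) (by omega)
    obtain ⟨P, Q, hPQ⟩ := h (i + 1) (by omega) him
    refine ⟨P • p + Q • X m, Submodule.add_mem _ (Submodule.smul_mem _ _ hp)
      (Submodule.smul_mem _ _ hmem), fun t ht => ?_⟩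
    have heq : X (i + 1) - (P • p + Q • X m) =
        (X (i + 1) - (P • X (i + 1 - 1) + Q • X m)) + P • (X i - p) := by
      rw [Nat.add_sub_cancel, smul_sub]
      abel
    rw [heq, hB.add_left, hB.smul_left, hpo t ht, hPQ t (by omega), mul_zero, add_zero]

/-- Each future `X i` is a combination of `X j` and `X m` plus a residual. The residuals are jointly
independent of the past and `X m`, so a future event sees the past only through `X j` and `X m`. -/
lemma IsZMNG.isCML_of_isOneStep (hX : IsZMNG μ N fun k => (X k : Ω → Fin d → ℝ))
    (hm : ∀ k ≤ N, Measurable (X k : Ω → Fin d → ℝ)) {m : ℕ} (hmN : m ≤ N)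
    (h : IsOneStep (covForm μ d) X m) : IsCML μ (fun k => (X k : Ω → Fin d → ℝ)) 0 m := by
  have hB := isCovForm_covForm (μ := μ) (d := d)
  intro j _ hjm A hA
  have hreg : ∀ i, ∃ p : sqIntegrable μ d, i ∈ Set.Ioc j m →
      p ∈ Submodule.span (SqMat d) (X '' {j, m}) ∧
        ∀ t, (t ≤ j ∨ t = m) → covForm μ d (X i - p) (X t) = 0 := fun i => by
    by_cases hi : i ∈ Set.Ioc j m
    · obtain ⟨p, hp⟩ := h.exists_regression hB hi.1.le hi.2
      exact ⟨p, fun _ => hp⟩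
    · exact ⟨0, fun h => absurd h hi⟩
  choose p hp using hreg
  have hsub : ∀ t ∈ ({j, m} : Set ℕ), t ∈ Set.Iic N := by
    rintro t (rfl | rfl)
    · exact hjm.trans hmN
    · exact hmN
  have hspan : ∀ i ∈ Set.Ioc j m, X i - p i ∈ Submodule.span (SqMat d) (X '' Set.Iic N) :=
    fun i hi => Submodule.sub_mem _ (Submodule.subset_span ⟨i, hi.2.trans hmN, rfl⟩)
      (span_image_mono X hsub (hp i hi).1)
  have hpast : ∀ t ∈ Set.Icc 0 j ∪ {m}, t ≤ j ∨ t = m := by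
    rintro t (ht | ht)
    · exact Or.inl ht.2
    · exact Or.inr ht
  have hpastN : ∀ t ∈ Set.Icc 0 j ∪ {m}, t ≤ N := fun t ht => by
    rcases hpast t ht with h1 | h1 <;> omega
  refine condProb_ae_eq_of_indep
    (m₃ := sigmaOf (fun i => ((X i - p i : sqIntegrable μ d) : Ω → Fin d → ℝ)) (Set.Ioc j m))
    (sigmaOf_le fun t ht => hm t (hpastN t ht)) ?_
    (sigmaOf_le fun i hi => measurable_of_mem_span (fun t ht => hm t ht) (hspan i hi)) ?_ ?_
  · refine sigmaOf_le fun t ht => measurable_sigmaOf ?_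
    rcases ht with rfl | rfl
    · exact Or.inl ⟨Nat.zero_le _, le_rfl⟩
    · exact Or.inr rfl
  · exact hX.indep_sigmaOf (Y := fun i => X i - p i) (Z := X) (Set.toFinite _) (Set.toFinite _)
      hspan (fun t ht => Submodule.subset_span ⟨t, hpastN t ht, rfl⟩)
      (fun i hi t ht => (hp i hi).2 t (hpast t ht))
  · refine sigmaOf_le (fun i hi => ?_) A hA
    have h1 : (X i : Ω → Fin d → ℝ) =
        ((X i - p i : sqIntegrable μ d) : Ω → Fin d → ℝ) + (p i : Ω → Fin d → ℝ) := by
      rw [← Submodule.coe_add, sub_add_cancel]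
    rw [h1]
    refine Measurable.add ?_ ?_
    · exact (measurable_sigmaOf
        (X := fun i => ((X i - p i : sqIntegrable μ d) : Ω → Fin d → ℝ)) hi).mono
        le_sup_left le_rfl
    · exact (measurable_of_mem_span (fun t ht => measurable_sigmaOf
        (X := fun i => (X i : Ω → Fin d → ℝ)) ht) (hp i hi).1).mono le_sup_right le_rfl

end Markov

/-! ### Passage between almost sure and exact identities, and the two directions. -/

open scoped Matrix.Module

lemma map_modelRhs {d N k₂ : ℕ} {E F : Type*} [AddCommGroup E] [Module (SqMat d) E]
    [AddCommGroup F] [Module (SqMat d) F] (f : E →ₗ[SqMat d] F) {X : ℕ → E} {Y : ℕ → F}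
    (hN : k₂ < N) (h : ∀ k ≤ N, f (X k) = Y k) (g : ℕ → SqMat d) {k : ℕ} (hk : k ≤ N) :
    f (modelRhs N k₂ g X k) = modelRhs N k₂ g Y k := by
  unfold modelRhs
  split_ifs with h1 h2 h3 h4
  · exact map_zero f
  · rw [map_sum]
    refine Finset.sum_congr rfl fun i hi => ?_
    rw [map_smul, h i ((Finset.mem_Icc.1 hi).2.trans hN.le)]
  · rw [map_smul, h _ hN.le]
  · rw [map_add, map_smul, map_smul, h _ (by omega), h _ hN.le]
  · rw [map_add, map_smul, map_smul, h _ (by omega), h _ le_rfl]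

section Final

variable {Ω : Type*} [MeasurableSpace Ω] {μ : Measure Ω} {d N k₂ : ℕ}

lemma obeysModel_iff {G : ℕ → ℕ → SqMat d} {e X : ℕ → Ω → Fin d → ℝ} (hk₂ : 1 ≤ k₂)
    (hN : k₂ < N) :
    ObeysModel μ N k₂ G e X ↔ ∀ k ≤ N, X k =ᵐ[μ] modelRhs N k₂ (G k) X k + e k := by
  constructor
  · intro h k hk
    unfold modelRhs
    split_ifs with h1 h2 h3 h4
    · subst h1
      filter_upwards [h.waypoint] with ω hω
      rw [zero_add, hω]
    · subst h2
      filter_upwards [h.destination] with ω hω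
      rw [hω, Pi.add_apply, Finset.sum_apply]
      rfl
    · subst h3
      exact h.initial
    · exact h.before k (by omega) h4
    · exact h.after k (by omega) (by omega)
  · intro h
    refine ⟨fun k hk hkk => ?_, ?_, ?_, ?_, fun k hk hkN => ?_⟩
    · have := h k (by omega)
      rwa [modelRhs, if_neg (by omega), if_neg (by omega), if_neg (by omega), if_pos hkk] at this
    · have := h k₂ hN.le
      rwa [modelRhs, if_pos rfl, zero_add] at this
    · have := h 0 (by omega)
      rwa [modelRhs, if_neg (by omega), if_neg (by omega), if_pos rfl] at this
    · have := h N le_rfl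
      rw [modelRhs, if_neg (by omega), if_pos rfl] at this
      filter_upwards [this] with ω hω
      rw [hω, Pi.add_apply, Finset.sum_apply]
      rfl
    · have := h k (by omega)
      rwa [modelRhs, if_neg (by omega), if_neg (by omega), if_neg (by omega),
        if_neg (by omega)] at this

lemma exists_lift {X : ℕ → Ω → Fin d → ℝ} (h : ∀ k ≤ N, X k ∈ sqIntegrable μ d) :
    ∃ Y : ℕ → sqIntegrable μ d, ∀ k ≤ N, (Y k : Ω → Fin d → ℝ) = X k :=
  ⟨fun k => if hk : k ≤ N then ⟨X k, h k hk⟩ else 0, fun k hk => by simp [hk]⟩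

lemma sigmaOf_congr {Ω : Type*} {d : ℕ} {X Y : ℕ → Ω → Fin d → ℝ} {s : Set ℕ}
    (h : ∀ i ∈ s, X i = Y i) : sigmaOf X s = sigmaOf Y s :=
  iSup_congr fun i => iSup_congr fun hi => by rw [h i hi]

lemma IsCML.congr {X Y : ℕ → Ω → Fin d → ℝ} {m : ℕ} (hX : IsCML μ X 0 m)
    (h : ∀ k ≤ m, X k = Y k) : IsCML μ Y 0 m := by
  intro j h0 hj A hA
  have h1 : sigmaOf X (Set.Ioc j m) = sigmaOf Y (Set.Ioc j m) :=
    sigmaOf_congr fun i hi => h i hi.2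
  have h2 : sigmaOf X (Set.Icc 0 j ∪ {m}) = sigmaOf Y (Set.Icc 0 j ∪ {m}) :=
    sigmaOf_congr fun i hi => h i (by
      rcases hi with hi | rfl
      · exact hi.2.trans hj
      · exact le_rfl)
  have h3 : sigmaOf X {j, m} = sigmaOf Y {j, m} :=
    sigmaOf_congr fun i hi => h i (by
      rcases hi with rfl | rfl
      · exact hj
      · exact le_rfl)
  have := hX j h0 hj A (h1 ▸ hA)
  rwa [h2, h3] at this

lemma IsModel.span_noise {E : Type*} [AddCommGroup E] [Module (SqMat d) E] {X e : ℕ → E}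
    {G : ℕ → ℕ → SqMat d} (h : IsModel N k₂ G e X) (hN : k₂ < N) {k : ℕ} (hk : k ≤ N) :
    X k ∈ Submodule.span (SqMat d) (e '' Set.Iic N) ∧
      e k ∈ Submodule.span (SqMat d) (X '' Set.Iic N) :=
  ⟨span_image_mono e (fun _ ht => ht.1) ((h.isTriangular hN).mem_span_noise hk),
    span_image_mono X (fun _ ht => ht.1) ((h.isTriangular hN).noise_mem_span hk)⟩

lemma exists_model_of_isCML [IsProbabilityMeasure μ] (hk₂ : 1 ≤ k₂) (hN : k₂ < N)
    {X : ℕ → Ω → Fin d → ℝ} (hm : ∀ k ≤ N, Measurable (X k)) (hX : IsZMNG μ N X)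
    (hcN : IsCML μ X 0 N) (hc : IsCML μ X 0 k₂) :
    ∃ (G : ℕ → ℕ → SqMat d) (e : ℕ → Ω → Fin d → ℝ),
      IsWhiteZMNG μ N e ∧ ObeysModel μ N k₂ G e X ∧
        (∀ j i, j + 2 ≤ i → i < k₂ → (G N j)ᵀ * (covMat μ (e N))⁻¹ * G N i = 0) ∧
        (∀ l, l + 2 ≤ k₂ → (covMat μ (e l))⁻¹ * G l k₂ =
          (G (l + 1) l)ᵀ * (covMat μ (e (l + 1)))⁻¹ * G (l + 1) k₂ +
            (G N l)ᵀ * (covMat μ (e N))⁻¹ * G N k₂) := by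
  have hB := isCovForm_covForm (μ := μ) (d := d)
  obtain ⟨Y, hY⟩ := exists_lift fun k hk => hX.mem_sqIntegrable hk
  have hYX : ∀ k ≤ N, X k = (Y k : Ω → Fin d → ℝ) := fun k hk => (hY k hk).symm
  have hZ : IsZMNG μ N fun k => (Y k : Ω → Fin d → ℝ) :=
    hX.congr fun k hk => by rw [hYX k hk]
  have hYm : ∀ k ≤ N, Measurable (Y k : Ω → Fin d → ℝ) := fun k hk => by
    rw [hY k hk]; exact hm k hk
  have hsN : IsOneStep (covForm μ d) Y N := hZ.isOneStep_of_isCML hYm le_rfl (hcN.congr hYX)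
  have hs : IsOneStep (covForm μ d) Y k₂ :=
    hZ.isOneStep_of_isCML hYm hN.le (hc.congr fun k hk => hYX k (hk.trans hN.le))
  obtain ⟨G, e, hmodel, hw⟩ := exists_isModel hB hZ.isNondeg hN hsN hs
  have hcoeff := dualCoeff_eq_zero_iff.1 fun l j hlj hj =>
    hmodel.dualCoeff_eq_zero hB hZ.isNondeg hN hw hsN hlj hj
  refine ⟨G, fun k => e k, ⟨hZ.of_span (fun k hk => (hmodel.span_noise hN hk).2)
    (fun k hk => (hmodel.span_noise hN hk).1), hw⟩, ?_, hcoeff.1, hcoeff.2⟩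
  rw [obeysModel_iff hk₂ hN]
  intro k hk
  have h1 := congrArg Subtype.val (hmodel k hk)
  have h2 := map_modelRhs (sqIntegrable μ d).subtype hN hY (G k) hk
  rw [Submodule.coe_add, hY k hk] at h1
  rw [h1, ← h2]
  rfl

lemma isCML_of_model [IsProbabilityMeasure μ] (hk₂ : 1 ≤ k₂) (hN : k₂ < N)
    {X : ℕ → Ω → Fin d → ℝ} (hm : ∀ k ≤ N, Measurable (X k))
    {G : ℕ → ℕ → SqMat d} {e : ℕ → Ω → Fin d → ℝ} (he : IsWhiteZMNG μ N e)
    (hmod : ObeysModel μ N k₂ G e X)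
    (h₁ : ∀ j i, j + 2 ≤ i → i < k₂ → (G N j)ᵀ * (covMat μ (e N))⁻¹ * G N i = 0)
    (h₂ : ∀ l, l + 2 ≤ k₂ → (covMat μ (e l))⁻¹ * G l k₂ =
      (G (l + 1) l)ᵀ * (covMat μ (e (l + 1)))⁻¹ * G (l + 1) k₂ +
        (G N l)ᵀ * (covMat μ (e N))⁻¹ * G N k₂) :
    IsZMNG μ N X ∧ IsCML μ X 0 N ∧ IsCML μ X 0 k₂ := by
  have hB := isCovForm_covForm (μ := μ) (d := d)
  rw [obeysModel_iff hk₂ hN] at hmod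
  -- The noise, not `X`, is modified on a null set so that the model holds everywhere: the
  -- σ-algebras in `IsCML` depend on the actual functions `X k`, whereas only the law and the
  -- covariances of the noise matter.
  set f : ℕ → Ω → Fin d → ℝ := fun k => X k - modelRhs N k₂ (G k) X k with hf
  have hef : ∀ k ≤ N, e k =ᵐ[μ] f k := fun k hk => by
    filter_upwards [hmod k hk] with ω hω
    change e k ω = X k ω - modelRhs N k₂ (G k) X k ω
    rw [hω, Pi.add_apply, add_sub_cancel_left]
  have hfm : IsModel N k₂ G f X := fun k _ => (add_sub_cancel _ _).symm
  have hfZ : IsZMNG μ N f := he.toIsZMNG.congr hef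
  have hXmem : ∀ k ≤ N, X k ∈ sqIntegrable μ d := fun k hk => by
    refine (Submodule.span_le.2 ?_) (hfm.span_noise hN hk).1
    rintro _ ⟨t, ht, rfl⟩
    exact hfZ.mem_sqIntegrable ht
  obtain ⟨Y, hY⟩ := exists_lift hXmem
  obtain ⟨g, hg⟩ := exists_lift fun k hk => hfZ.mem_sqIntegrable hk
  have hmodel : IsModel N k₂ G g Y := fun k hk => by
    apply Subtype.ext
    have h2 := map_modelRhs (sqIntegrable μ d).subtype hN hY (G k) hk
    rw [Submodule.coe_add, hY k hk, hg k hk]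
    rw [Submodule.subtype_apply] at h2
    rw [h2]
    exact hfm k hk
  have hcov : ∀ i ≤ N, ∀ j ≤ N, covForm μ d (g i) (g j) = crossCov μ (e i) (e j) := by
    intro i hi j hj
    rw [covForm, hg i hi, hg j hj]
    exact (crossCov_congr (hef i hi) (hef j hj)).symm
  have hw : ∀ i ≤ N, ∀ j ≤ N, i ≠ j → covForm μ d (g i) (g j) = 0 := fun i hi j hj hij => by
    rw [hcov i hi j hj, he.white i hi j hj hij]
  have hgZ : IsZMNG μ N fun k => (g k : Ω → Fin d → ℝ) :=
    hfZ.congr fun k hk => by rw [hg k hk]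
  have hYZ : IsZMNG μ N fun k => (Y k : Ω → Fin d → ℝ) :=
    hgZ.of_span (fun k hk => (hmodel.span_noise hN hk).1)
      (fun k hk => (hmodel.span_noise hN hk).2)
  have hYm : ∀ k ≤ N, Measurable (Y k : Ω → Fin d → ℝ) := fun k hk => by
    rw [hY k hk]; exact hm k hk
  have hvar : ∀ k ≤ N, covForm μ d (g k) (g k) = covMat μ (e k) := fun k hk => hcov k hk k hk
  have hcoeff := dualCoeff_eq_zero_iff (B := covForm μ d) (N := N) (k₂ := k₂) (G := G) (e := g).2
    ⟨fun j i hij hi => by rw [hvar N le_rfl]; exact h₁ j i hij hi,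
      fun l hl => by
        rw [hvar N le_rfl, hvar l (by omega), hvar (l + 1) (by omega)]; exact h₂ l hl⟩
  refine ⟨hYZ.congr fun k hk => by rw [hY k hk], ?_, ?_⟩
  · exact (hYZ.isCML_of_isOneStep hYm le_rfl
      (hmodel.isOneStep_destination hB hYZ.isNondeg hN hw hcoeff)).congr hY
  · exact (hYZ.isCML_of_isOneStep hYm hN.le (hmodel.isOneStep_waypoint hB hN hw)).congr
      fun k hk => hY k (hk.trans hN.le)

end Final

end GaussCM

theorem mainTheorem6 {Ω : Type*} [MeasurableSpace Ω] (μ : Measure Ω) [IsProbabilityMeasure μ]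
    (d N k₂ : ℕ) (hk₂ : 1 ≤ k₂) (hN : k₂ < N)
    (X : ℕ → Ω → Fin d → ℝ) (hX : ∀ k ≤ N, Measurable (X k)) :
    (GaussCM.IsZMNG μ N X ∧ GaussCM.IsCML μ X 0 N ∧ GaussCM.IsCML μ X 0 k₂) ↔
      ∃ (G : ℕ → ℕ → Matrix (Fin d) (Fin d) ℝ) (e : ℕ → Ω → Fin d → ℝ),
        GaussCM.IsWhiteZMNG μ N e ∧
        GaussCM.ObeysModel μ N k₂ G e X ∧
        (∀ j i, j + 2 ≤ i → i < k₂ →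
          (G N j)ᵀ * (GaussCM.covMat μ (e N))⁻¹ * G N i = 0) ∧
        (∀ l, l + 2 ≤ k₂ →
          (GaussCM.covMat μ (e l))⁻¹ * G l k₂ =
            (G (l + 1) l)ᵀ * (GaussCM.covMat μ (e (l + 1)))⁻¹ * G (l + 1) k₂ +
              (G N l)ᵀ * (GaussCM.covMat μ (e N))⁻¹ * G N k₂) := by
  constructor
  · rintro ⟨hZ, hcN, hc⟩
    exact GaussCM.exists_model_of_isCML hk₂ hN hX hZ hcN hc
  · rintro ⟨G, e, he, hmod, h₁, h₂⟩
    exact GaussCM.isCML_of_model hk₂ hN hX he hmod h₁ h₂
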